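/- Let $\rho_{ab}$ be a two-mode zero-mean Gaussian state shared by Alice and Bob, with correlation matrix $V=\begin{pmatrix}A&C\\ C^T&B\end{pmatrix}$ (real symmetric $4\times4$ with $V+i(J\oplus J)\ge 0$, $J=\begin{pmatrix}0&1\\-1&0\end{pmatrix}$). Let $Z=\mathrm{diag}(1,-1)$ and $\Lambda=\mathrm{diag}(Z,I)$, and let $\nu$ be the lowest symplectic eigenvalue of the partial transpose $\Lambda V\Lambda$, i.e. the least $t\ge0$ such that $it$ is an eigenvalue of $(J\oplus J)\Lambda V\Lambda$. Suppose the state is entangled, $\nu<1$. The fidelity of Braunstein–Kimble teleportation of a coherent state through $V$ is $\mathcal F(V)=2/\sqrt{\det(2I+N)}$ with $N=ZAZ+ZC+C^TZ+B$. Let $\mathcal F_{opt}$ be the supremum of $\mathcal F(V')$ over all correlation matrices $V'$ obtained from $V$ by local Gaussian completely positive maps. In such a map each party adds finitely many ancillary modes in a Gaussian state, applies a Gaussian unitary (a symplectic transformation) to its mode and the ancillas, discards some of the ancillary modes and projects the others onto a Gaussian state. The state is called symmetric if $\det A=\det B$. Then: 1. $\mathcal F_{opt}\le \frac1{1+\nu}$,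 and $\mathcal F_{opt}=\frac1{1+\nu}$ if and only if the state is symmetric. Moreover some local Gaussian completely positive map gives fidelity $\frac1{1+\nu}$ if and only if the state is symmetric. 2. If the state is symmetric, the optimal local transformation is a local symplectic map. That is, every local Gaussian completely positive map giving fidelity $\mathcal F_{opt}$ on $V$ acts on correlation matrices as $U\mapsto (S_a\oplus S_b)\,U\,(S_a\oplus S_b)^T$ with symplectic $2\times2$ matrices $S_a,S_b$. Explicitly, there are a $4\times4$ symplectic matrix $T$ and a real $\mu$ with $T\Lambda V\Lambda T^T=\mathrm{diag}(\nu,\nu,\mu,\mu)$. For every such $T$ and $\mu$, the upper $2\times2$ blocks $W_a,W_b$ of $T$ (so that the first two rows of $T$ form $(W_a\ \ W_b)$) satisfy $\det W_a=\det W_b=\frac12$, so that $\theta:=\arctan\sqrt{\det W_a/\det W_b}=\pi/4$. Consider the maps $\omega_\theta:V\mapsto (S_a\oplus S_b)V(S_a\oplus S_b)^T+G_a\oplus G_b$ given by $S_a=ZW_aZ/\cos\theta$, $S_b=W_b/\cos\theta$, $G_a=(1-\tan^2\theta)I$, $G_b=0$ for $0<\theta\le\pi/4$, and by $S_a=ZW_aZ/\sin\theta$,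 $S_b=W_b/\sin\theta$, $G_a=0$, $G_b=(1-\cot^2\theta)I$ for $\pi/4\le\theta<\pi/2$. The member $\theta=\pi/4$ has $G_a=G_b=0$ and symplectic $S_a=\sqrt2\,ZW_aZ$, $S_b=\sqrt2\,W_b$, and it gives the fidelity $\mathcal F_{opt}$ on $V$. -/

import Mathlib

noncomputable section

open Matrix Real
open scoped ComplexOrder

namespace CVTeleport

/-- The single-mode symplectic form `J`. -/
def J : Matrix (Fin 2) (Fin 2) ℝ := !![0, 1; -1, 0]

/-- `Z = diag(1, -1)`. -/
def Z : Matrix (Fin 2) (Fin 2) ℝ := !![1, 0; 0, -1]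

/-- Phase-space indices of `k` modes: `(j, 0)` is `x_j` and `(j, 1)` is `p_j`. -/
abbrev Modes (k : ℕ) : Type := Fin k × Fin 2

/-- The symplectic form of `k` modes, `J ⊕ ⋯ ⊕ J`. -/
def Omega (k : ℕ) : Matrix (Modes k) (Modes k) ℝ :=
  Matrix.of fun i j => if i.1 = j.1 then J i.2 j.2 else 0

/-- The two-mode symplectic form `𝒥 = J ⊕ J`, Alice's mode first. -/
def JJ : Matrix (Fin 2 ⊕ Fin 2) (Fin 2 ⊕ Fin 2) ℝ := fromBlocks J 0 0 J

/-- `S` is symplectic for the form `w`. -/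
def IsSymplectic {ι : Type} [Fintype ι] (w S : Matrix ι ι ℝ) : Prop :=
  S * w * Sᵀ = w

/-- `V` is the correlation matrix of a quantum state on the phase space with form `w`:
it is real symmetric and satisfies the uncertainty principle `V + i w ≥ 0`. -/
def IsCM {ι : Type} [Fintype ι] (w V : Matrix ι ι ℝ) : Prop :=
  V.IsSymm ∧ (V.map Complex.ofReal + Complex.I • w.map Complex.ofReal).PosSemidef

/-- The noise matrix `N = Z A Z + Z C + Cᵀ Z + B` of a two-mode matrix with blocks
`A, C, Cᵀ, B`. -/
def noise (V : Matrix (Fin 2 ⊕ Fin 2) (Fin 2 ⊕ Fin 2) ℝ) : Matrix (Fin 2) (Fin 2) ℝ :=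
  Z * V.toBlocks₁₁ * Z + Z * V.toBlocks₁₂ + V.toBlocks₂₁ * Z + V.toBlocks₂₂

/-- Fidelity of the teleportation of a coherent state (`V_in = I`) when the shared Gaussian
state has correlation matrix `V`: `2 / √det(2 V_in + N)`. -/
def fidelity (V : Matrix (Fin 2 ⊕ Fin 2) (Fin 2 ⊕ Fin 2) ℝ) : ℝ :=
  2 / √((2 : ℝ) • (1 : Matrix (Fin 2) (Fin 2) ℝ) + noise V).det

/-- `Λ = diag(Z, I)`; the partial transpose of `V` is `Λ V Λ`. -/
def Lam : Matrix (Fin 2 ⊕ Fin 2) (Fin 2 ⊕ Fin 2) ℝ := fromBlocks Z 0 0 1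

/-- The symplectic eigenvalues of a two-mode matrix `M`: the `t ≥ 0` such that `i t` is an
eigenvalue of `𝒥 M`. -/
def symplecticSpectrum (M : Matrix (Fin 2 ⊕ Fin 2) (Fin 2 ⊕ Fin 2) ℝ) : Set ℝ :=
  {t | 0 ≤ t ∧ Complex.I * (t : ℂ) ∈ spectrum ℂ ((JJ * M).map Complex.ofReal)}

/-- The lowest symplectic eigenvalue `ν` of the partial transpose of `V`. -/
def nu (V : Matrix (Fin 2 ⊕ Fin 2) (Fin 2 ⊕ Fin 2) ℝ) : ℝ :=
  sInf (symplecticSpectrum (Lam * V * Lam))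

/-- A two-mode Gaussian state is symmetric if its two reduced states have the same local
symplectic invariant, `det A = det B`. -/
def IsSymmetricState (V : Matrix (Fin 2 ⊕ Fin 2) (Fin 2 ⊕ Fin 2) ℝ) : Prop :=
  V.toBlocks₁₁.det = V.toBlocks₂₂.det

/-- Phase-space indices of one system mode, `d` ancillary modes that will be discarded and `m`
ancillary modes that will be measured. -/
abbrev Dilated (d m : ℕ) : Type := Fin 2 ⊕ (Modes d ⊕ Modes m)

/-- The symplectic form of the ancillary modes. -/
def ancForm (d m : ℕ) : Matrix (Modes d ⊕ Modes m) (Modes d ⊕ Modes m) ℝ :=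
  fromBlocks (Omega d) 0 0 (Omega m)

/-- The symplectic form of the system mode and the ancillary modes. -/
def dilForm (d m : ℕ) : Matrix (Dilated d m) (Dilated d m) ℝ :=
  fromBlocks J 0 0 (ancForm d m)

/-- A single-mode Gaussian completely positive (GCP) operation: ancillary modes in a Gaussian
state with correlation matrix `σ` are added, a Gaussian unitary (symplectic matrix `S`) acts on
the system and the ancillas, `d` ancillary modes are discarded and `m` ancillary modes are
projected onto a Gaussian state with correlation matrix `τ`. It is trace preserving when
`m = 0`. -/
structure GCP where
  d : ℕ
  m : ℕ
  σ : Matrix (Modes d ⊕ Modes m) (Modes d ⊕ Modes m) ℝ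
  σ_cm : IsCM (ancForm d m) σ
  S : Matrix (Dilated d m) (Dilated d m) ℝ
  S_symplectic : IsSymplectic (dilForm d m) S
  τ : Matrix (Modes m) (Modes m) ℝ
  τ_cm : IsCM (Omega m) τ

/-- The correlation matrix of Alice's and Bob's systems and ancillas after the unitaries, when
the shared state has correlation matrix `V`. -/
def dilatedCM (Ea Eb : GCP) (V : Matrix (Fin 2 ⊕ Fin 2) (Fin 2 ⊕ Fin 2) ℝ) :
    Matrix (Dilated Ea.d Ea.m ⊕ Dilated Eb.d Eb.m) (Dilated Ea.d Ea.m ⊕ Dilated Eb.d Eb.m) ℝ :=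
  fromBlocks Ea.S 0 0 Eb.S *
    fromBlocks (fromBlocks V.toBlocks₁₁ 0 0 Ea.σ) (fromBlocks V.toBlocks₁₂ 0 0 0)
      (fromBlocks V.toBlocks₂₁ 0 0 0) (fromBlocks V.toBlocks₂₂ 0 0 Eb.σ) *
    (fromBlocks Ea.S 0 0 Eb.S)ᵀ

/-- The coordinates of the two output modes. -/
def outIdx (Ea Eb : GCP) : Fin 2 ⊕ Fin 2 → Dilated Ea.d Ea.m ⊕ Dilated Eb.d Eb.m :=
  Sum.map Sum.inl Sum.inl

/-- The coordinates of the measured modes. -/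
def measIdx (Ea Eb : GCP) : Modes Ea.m ⊕ Modes Eb.m → Dilated Ea.d Ea.m ⊕ Dilated Eb.d Eb.m :=
  Sum.map (Sum.inr ∘ Sum.inr) (Sum.inr ∘ Sum.inr)

/-- The correlation matrix after the local GCP map `Ea ⊗ Eb`. Discarding modes drops their rows
and columns; projecting modes onto a Gaussian state with correlation matrix `τ` turns
`(P, R; Rᵀ, Q)` into `P - R (Q + τ)⁻¹ Rᵀ`, whatever the displacement of that state. -/
def applyLocal (Ea Eb : GCP) (V : Matrix (Fin 2 ⊕ Fin 2) (Fin 2 ⊕ Fin 2) ℝ) :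
    Matrix (Fin 2 ⊕ Fin 2) (Fin 2 ⊕ Fin 2) ℝ :=
  let M := dilatedCM Ea Eb V
  M.submatrix (outIdx Ea Eb) (outIdx Ea Eb) -
    M.submatrix (outIdx Ea Eb) (measIdx Ea Eb) *
      (M.submatrix (measIdx Ea Eb) (measIdx Ea Eb) + fromBlocks Ea.τ 0 0 Eb.τ)⁻¹ *
      M.submatrix (measIdx Ea Eb) (outIdx Ea Eb)

/-- The optimal fidelity: the supremum of the teleportation fidelity over all local GCP maps. -/
def Fopt (V : Matrix (Fin 2 ⊕ Fin 2) (Fin 2 ⊕ Fin 2) ℝ) : ℝ :=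
  sSup (Set.range fun E : GCP × GCP => fidelity (applyLocal E.1 E.2 V))

/-- The action `V ↦ S V Sᵀ + G` with `S = Sa ⊕ Sb` and `G = Ga ⊕ Gb`. -/
def localAct (Sa Sb Ga Gb : Matrix (Fin 2) (Fin 2) ℝ)
    (V : Matrix (Fin 2 ⊕ Fin 2) (Fin 2 ⊕ Fin 2) ℝ) : Matrix (Fin 2 ⊕ Fin 2) (Fin 2 ⊕ Fin 2) ℝ :=
  fromBlocks Sa 0 0 Sb * V * (fromBlocks Sa 0 0 Sb)ᵀ + fromBlocks Ga 0 0 Gb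

/-- The angle `θ` of the upper blocks `Wa, Wb` of a matrix diagonalizing the partial transpose:
`tan θ = √(det Wa / det Wb)`. -/
def theta (Wa Wb : Matrix (Fin 2) (Fin 2) ℝ) : ℝ := arctan √(Wa.det / Wb.det)

/-- Alice's matrix `S_a` in the map `ω_θ`. -/
def omegaSa (θ : ℝ) (Wa : Matrix (Fin 2) (Fin 2) ℝ) : Matrix (Fin 2) (Fin 2) ℝ :=
  if θ ≤ π / 4 then (cos θ)⁻¹ • (Z * Wa * Z) else (sin θ)⁻¹ • (Z * Wa * Z)

/-- Bob's matrix `S_b` in the map `ω_θ`. -/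
def omegaSb (θ : ℝ) (Wb : Matrix (Fin 2) (Fin 2) ℝ) : Matrix (Fin 2) (Fin 2) ℝ :=
  if θ ≤ π / 4 then (cos θ)⁻¹ • Wb else (sin θ)⁻¹ • Wb

/-- Alice's noise `G_a` in the map `ω_θ`. -/
def omegaGa (θ : ℝ) : Matrix (Fin 2) (Fin 2) ℝ :=
  if θ ≤ π / 4 then (1 - tan θ ^ 2) • 1 else 0

/-- Bob's noise `G_b` in the map `ω_θ`. -/
def omegaGb (θ : ℝ) : Matrix (Fin 2) (Fin 2) ℝ :=
  if θ ≤ π / 4 then 0 else (1 - cot θ ^ 2) • 1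

/-- `T` is symplectic and brings the partial transpose of `V` to `diag(ν, ν, μ, μ)`. -/
def Diagonalizes (T : Matrix (Fin 2 ⊕ Fin 2) (Fin 2 ⊕ Fin 2) ℝ) (μ : ℝ)
    (V : Matrix (Fin 2 ⊕ Fin 2) (Fin 2 ⊕ Fin 2) ℝ) : Prop :=
  IsSymplectic JJ T ∧ T * (Lam * V * Lam) * Tᵀ = fromBlocks (nu V • 1) 0 0 (μ • 1)

end CVTeleport

end

/-! The proof rests on the inequalities `V + i (x J ⊕ y J) ≥ 0` with `|x|, |y| ≤ 1`. Every local
Gaussian map preserves them: the ancillas satisfy the corresponding scaled uncertainty relations,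
each party's symplectic matrix fixes its own form, and a projection is a Schur complement
(`posSemidef_applyLocal`). Compressing such an inequality with the rows `(Z I)` gives `N + i (y - x)
J ≥ 0`. For `y ≥ x` this bounds the determinant and trace of `N` from below, so the fidelity is at
most `2 / (2 + (y - x))` (`fidelity_bound`).

Williamson's theorem for the partial transpose gives the inequality at `(x, y) = (-ν, ν)`, hence the
bound `1 / (1 + ν)`.

Let `Wa, Wb` be the upper blocks of a diagonalizing `T`. Always `det Wa + det Wb = 1`, and `det A -
det B = (ν² - μ²) (det Wa - det Wb)`. Entanglement gives `ν < μ`, so the state is symmetric exactly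
when `det Wa = det Wb = 1/2`. In that case `√2 Z Wa Z` and `√2 Wb` are symplectic, and they produce
noise `2ν I`, which attains the bound.

If `det Wa ≠ det Wb`, then `diag(ν, ν, μ, μ) + i ν (J ⊕ J)` has a one-dimensional kernel. Moving
`(x, y)` slightly in a suitable direction increases `y - x` and keeps positivity
(`exists_stronger_of_det_ne`). The supremum is then strictly below `1 / (1 + ν)`.

Rigidity: attaining the bound forces noise `2ν I`, and so a null vector of the output inequality at
`(-ν, ν)`. Since `ν < 1`, the forms of ancillas and measured states are strictly positive there. The
null vector therefore has no ancillary component, which decouples the ancillas from the output mode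
(`decoupled_of_null`). -/

noncomputable section

open Matrix
open scoped ComplexOrder

namespace CVTeleport

/-! ### Positivity of `V + i w` under congruence, scaling of `w` and conditioning -/

section Hermitian

variable {ι κ : Type} [Fintype ι] [Fintype κ]

/-- The Hermitian matrix `V + i w`. -/
def herm {ι : Type} (V w : Matrix ι ι ℝ) : Matrix ι ι ℂ :=
  V.map Complex.ofReal + Complex.I • w.map Complex.ofReal

omit [Fintype ι] in
theorem herm_apply (V w : Matrix ι ι ℝ) (i j : ι) :
    herm V w i j = (V i j : ℂ) + Complex.I * (w i j : ℂ) := by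
  simp [herm]

theorem map_ofReal_mul {l m n : Type} [Fintype m] (M : Matrix l m ℝ) (N : Matrix m n ℝ) :
    (M * N).map Complex.ofReal = M.map Complex.ofReal * N.map Complex.ofReal :=
  Matrix.map_mul (f := Complex.ofRealHom)

theorem conjTranspose_map_ofReal {m n : Type} (M : Matrix m n ℝ) :
    (M.map Complex.ofReal)ᴴ = Mᵀ.map Complex.ofReal := by
  ext i j
  simp [conjTranspose_apply]

omit [Fintype κ] in
theorem herm_congr (S : Matrix κ ι ℝ) (V w : Matrix ι ι ℝ) :
    S.map Complex.ofReal * herm V w * (S.map Complex.ofReal)ᴴ =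
      herm (S * V * Sᵀ) (S * w * Sᵀ) := by
  simp only [herm, conjTranspose_map_ofReal, map_ofReal_mul, Matrix.mul_add, Matrix.add_mul,
    Matrix.mul_smul, Matrix.smul_mul]

theorem posSemidef_herm_congr {V w : Matrix ι ι ℝ} (h : (herm V w).PosSemidef)
    (S : Matrix κ ι ℝ) : (herm (S * V * Sᵀ) (S * w * Sᵀ)).PosSemidef := by
  rw [← herm_congr]
  exact h.mul_mul_conjTranspose_same _

omit [Fintype ι] in
theorem herm_add (V w V' w' : Matrix ι ι ℝ) :
    herm V w + herm V' w' = herm (V + V') (w + w') := by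
  ext i j
  simp only [herm_apply, Matrix.add_apply]
  push_cast
  ring

omit [Fintype ι] in
theorem smul_herm (r : ℝ) (V w : Matrix ι ι ℝ) :
    (r : ℂ) • herm V w = herm (r • V) (r • w) := by
  ext i j
  simp only [herm_apply, Matrix.smul_apply, smul_eq_mul]
  push_cast
  ring

omit [Fintype ι] [Fintype κ] in
theorem herm_submatrix (V w : Matrix ι ι ℝ) (g : κ → ι) :
    (herm V w).submatrix g g = herm (V.submatrix g g) (w.submatrix g g) := rfl

omit [Fintype ι] [Fintype κ] in
theorem herm_fromBlocks (A A' : Matrix ι ι ℝ) (B B' : Matrix ι κ ℝ) (C C' : Matrix κ ι ℝ)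
    (D D' : Matrix κ κ ℝ) :
    herm (fromBlocks A B C D) (fromBlocks A' B' C' D') =
      fromBlocks (herm A A') (B.map Complex.ofReal + Complex.I • B'.map Complex.ofReal)
        (C.map Complex.ofReal + Complex.I • C'.map Complex.ofReal) (herm D D') := by
  simp only [herm, fromBlocks_map, fromBlocks_smul, fromBlocks_add]

omit [Fintype ι] [Fintype κ] in
theorem herm_fromBlocks_diagonal (A A' : Matrix ι ι ℝ) (D D' : Matrix κ κ ℝ) :
    herm (fromBlocks A 0 0 D) (fromBlocks A' 0 0 D') =
      fromBlocks (herm A A') 0 0 (herm D D') := by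
  rw [herm_fromBlocks]
  simp

theorem posSemidef_fromBlocks_diagonal {A : Matrix ι ι ℂ} {D : Matrix κ κ ℂ}
    (hA : A.PosSemidef) (hD : D.PosSemidef) : (fromBlocks A 0 0 D).PosSemidef := by
  refine .of_dotProduct_mulVec_nonneg (hA.1.fromBlocks (by simp) hD.1) fun x => ?_
  have h : star x ⬝ᵥ (fromBlocks A 0 0 D *ᵥ x) =
      star (x ∘ Sum.inl) ⬝ᵥ (A *ᵥ (x ∘ Sum.inl)) + star (x ∘ Sum.inr) ⬝ᵥ (D *ᵥ (x ∘ Sum.inr)) := by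
    rw [fromBlocks_mulVec]
    simp [dotProduct, Fintype.sum_sum_type]
  rw [h]
  exact add_nonneg (hA.dotProduct_mulVec_nonneg _) (hD.dotProduct_mulVec_nonneg _)

omit [Fintype ι] in
/-- Complex conjugation of `V + i w` for a positive semidefinite `V + i w`. -/
theorem posSemidef_herm_neg {V w : Matrix ι ι ℝ} (h : (herm V w).PosSemidef) :
    (herm V (-w)).PosSemidef := by
  have e : herm V (-w) = (herm V w)ᵀ := by
    rw [← h.1.transpose]
    ext i j
    simp [herm_apply, conjTranspose_apply]
  rw [e]
  exact h.transpose

-- The form `t w` is an average of `w` and `-w` with weights `(1 ± t) / 2`. Complex conjugation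
-- makes `-w` as admissible as `w`, so the whole interval `|t| ≤ 1` is.
omit [Fintype ι] in
theorem herm_convex (V w : Matrix ι ι ℝ) (t : ℝ) :
    herm V (t • w) = (((1 + t) / 2 : ℝ) : ℂ) • herm V w + (((1 - t) / 2 : ℝ) : ℂ) • herm V (-w) := by
  rw [smul_herm, smul_herm, herm_add]
  congr 1
  · rw [← add_smul]; ring_nf; simp
  · rw [smul_neg, ← sub_eq_add_neg, ← sub_smul]; ring_nf

omit [Fintype ι] in
theorem posSemidef_herm_smul {V w : Matrix ι ι ℝ} (h : (herm V w).PosSemidef) {t : ℝ}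
    (ht : |t| ≤ 1) : (herm V (t • w)).PosSemidef := by
  obtain ⟨h1, h2⟩ := abs_le.1 ht
  rw [herm_convex]
  refine (h.smul ?_).add ((posSemidef_herm_neg h).smul ?_)
  · exact_mod_cast (by linarith : (0 : ℝ) ≤ (1 + t) / 2)
  · exact_mod_cast (by linarith : (0 : ℝ) ≤ (1 - t) / 2)

theorem posDef_of_posSemidef {M : Matrix ι ι ℂ} (h : M.PosSemidef)
    (h0 : ∀ x, M *ᵥ x = 0 → x = 0) : M.PosDef := by
  refine .of_dotProduct_mulVec_pos h.1 fun x hx => ?_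
  refine lt_of_le_of_ne (h.dotProduct_mulVec_nonneg x) fun e => hx (h0 x ?_)
  exact (h.dotProduct_mulVec_zero_iff x).1 e.symm

theorem mulVec_injective_of_posDef {M : Matrix ι ι ℂ} (hM : M.PosDef) (y : ι → ℂ)
    (hy : M *ᵥ y = 0) : y = 0 := by
  by_contra hne
  have := hM.dotProduct_mulVec_pos hne
  rw [hy, dotProduct_zero] at this
  exact lt_irrefl _ this

/-- If `M` and `N` are positive semidefinite, a null vector of `M + N` is one of `M`. -/
theorem mulVec_eq_zero_of_add {M N : Matrix ι ι ℂ} (hM : M.PosSemidef) (hN : N.PosSemidef)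
    {x : ι → ℂ} (h : star x ⬝ᵥ ((M + N) *ᵥ x) = 0) : M *ᵥ x = 0 ∧ N *ᵥ x = 0 := by
  rw [add_mulVec, dotProduct_add] at h
  have h1 := hM.dotProduct_mulVec_nonneg x
  have h2 := hN.dotProduct_mulVec_nonneg x
  obtain ⟨e1, e2⟩ := (add_eq_zero_iff_of_nonneg h1 h2).1 h
  exact ⟨(hM.dotProduct_mulVec_zero_iff x).1 e1, (hN.dotProduct_mulVec_zero_iff x).1 e2⟩

/-- For `|t| < 1` both weights in `herm_convex` are positive, so a null vector is annihilated by `V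
+ i w` and by `V - i w`. Their difference is a multiple of the nondegenerate `w`. -/
theorem posDef_herm_smul {V w : Matrix ι ι ℝ} (h : (herm V w).PosSemidef)
    (hw : ∀ x, w.map Complex.ofReal *ᵥ x = 0 → x = 0) {t : ℝ} (ht : |t| < 1) :
    (herm V (t • w)).PosDef := by
  obtain ⟨h1, h2⟩ := abs_lt.1 ht
  refine posDef_of_posSemidef (posSemidef_herm_smul h ht.le) fun x hx => hw x ?_
  have p1 : (0 : ℝ) < (1 + t) / 2 := by linarith
  have p2 : (0 : ℝ) < (1 - t) / 2 := by linarith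
  obtain ⟨e1, e2⟩ := mulVec_eq_zero_of_add
    (h.smul (show (0 : ℂ) ≤ (((1 + t) / 2 : ℝ) : ℂ) by exact_mod_cast p1.le))
    ((posSemidef_herm_neg h).smul (show (0 : ℂ) ≤ (((1 - t) / 2 : ℝ) : ℂ) by exact_mod_cast p2.le))
    (x := x) (by rw [← herm_convex, hx, dotProduct_zero])
  rw [smul_mulVec, smul_eq_zero] at e1 e2
  have q1 := e1.resolve_left (by exact_mod_cast p1.ne')
  have q2 := e2.resolve_left (by exact_mod_cast p2.ne')
  have e : Complex.I • w.map Complex.ofReal =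
      (1 / 2 : ℂ) • (herm V w - herm V (-w)) := by
    ext i j
    simp only [herm_apply, Matrix.smul_apply, Matrix.sub_apply, smul_eq_mul, Matrix.neg_apply,
      Matrix.map_apply]
    push_cast
    ring
  have e3 : (Complex.I • w.map Complex.ofReal) *ᵥ x = 0 := by
    rw [e, smul_mulVec, sub_mulVec, q1, q2, sub_zero, smul_zero]
  rw [smul_mulVec, smul_eq_zero] at e3
  exact e3.resolve_left Complex.I_ne_zero

omit [Fintype ι] in
theorem herm_zero_right (V : Matrix ι ι ℝ) : herm V 0 = V.map Complex.ofReal := by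
  ext i j
  simp [herm_apply]

theorem posDef_of_map_ofReal {V : Matrix ι ι ℝ} (h : (V.map Complex.ofReal).PosDef) :
    V.PosDef := by
  refine .of_dotProduct_mulVec_pos ?_ fun x hx => ?_
  · ext i j
    have := congrFun (congrFun h.1 i) j
    simpa [conjTranspose_apply] using this
  · have hX : (fun i => (x i : ℂ)) ≠ 0 := fun e => hx (by
      ext i
      simpa using congrFun e i)
    have := h.dotProduct_mulVec_pos hX
    have e : star (fun i => (x i : ℂ)) ⬝ᵥ (V.map Complex.ofReal *ᵥ fun i => (x i : ℂ)) =
        ((star x ⬝ᵥ (V *ᵥ x) : ℝ) : ℂ) := by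
      simp [dotProduct, mulVec]
    rw [e] at this
    exact_mod_cast this

/-- For a Hermitian matrix only the real part of the quadratic form matters. -/
theorem posSemidef_iff_re {M : Matrix ι ι ℂ} (hM : M.IsHermitian) :
    M.PosSemidef ↔ ∀ x, 0 ≤ (star x ⬝ᵥ (M *ᵥ x)).re := by
  constructor
  · intro h x
    exact (Complex.nonneg_iff.1 (h.dotProduct_mulVec_nonneg x)).1
  · intro h
    refine .of_dotProduct_mulVec_nonneg hM fun x => Complex.nonneg_iff.2 ⟨h x, ?_⟩
    have := hM.im_star_dotProduct_mulVec_self x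
    simpa using this.symm

theorem map_ofReal_inv [DecidableEq ι] (M : Matrix ι ι ℝ) :
    (M⁻¹).map Complex.ofReal = (M.map Complex.ofReal)⁻¹ := by
  have h1 : (M.map Complex.ofReal).det = (M.det : ℂ) :=
    (RingHom.map_det Complex.ofRealHom M).symm
  have h2 : M.adjugate.map Complex.ofReal = (M.map Complex.ofReal).adjugate :=
    RingHom.map_adjugate Complex.ofRealHom M
  rw [inv_def, inv_def, h1, ← h2]
  ext i j
  simp

omit [Fintype ι] in
theorem herm_sub_left (P M w : Matrix ι ι ℝ) :
    herm (P - M) w = herm P w - M.map Complex.ofReal := by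
  ext i j
  simp only [herm_apply, Matrix.sub_apply, Matrix.map_apply]
  push_cast
  ring

/-- Projecting onto a Gaussian state with correlation matrix `τ` preserves `V + i w ≥ 0`. -/
theorem posSemidef_herm_schur [DecidableEq κ] {P w : Matrix ι ι ℝ} {R : Matrix ι κ ℝ}
    {Q τ w' : Matrix κ κ ℝ}
    (h : (herm (fromBlocks P R Rᵀ Q) (fromBlocks w 0 0 w')).PosSemidef)
    (hτ : (herm τ (-w')).PosSemidef) (hd : ((Q + τ).map Complex.ofReal).PosDef) :
    (herm (P - R * (Q + τ)⁻¹ * Rᵀ) w).PosSemidef := by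
  -- Adding `τ - i w'` cancels the form on the measured modes. The lower block becomes the real
  -- matrix `Q + τ`, and the conditional matrix is its Schur complement.
  have h1 := h.add (posSemidef_fromBlocks_diagonal
    (PosSemidef.zero (n := ι) (R := ℂ)) hτ)
  have e : herm (fromBlocks P R Rᵀ Q) (fromBlocks w 0 0 w') +
      fromBlocks 0 0 0 (herm τ (-w')) =
      fromBlocks (herm P w) (R.map Complex.ofReal) (R.map Complex.ofReal)ᴴ
        ((Q + τ).map Complex.ofReal) := by
    rw [herm_fromBlocks, fromBlocks_add, herm_add, add_neg_cancel, herm_zero_right,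
      conjTranspose_map_ofReal]
    simp
  have : Invertible ((Q + τ).map Complex.ofReal) := hd.isUnit.invertible
  rw [e, PosDef.fromBlocks₂₂ _ _ hd, conjTranspose_map_ofReal, ← map_ofReal_inv,
    ← map_ofReal_mul, ← map_ofReal_mul] at h1
  rwa [herm_sub_left]

/-- Null vectors of the conditional form come from null vectors of the joint form. -/
theorem exists_null_of_schur [DecidableEq κ] {P w : Matrix ι ι ℝ} {R : Matrix ι κ ℝ}
    {Q τ w' : Matrix κ κ ℝ}
    (h : (herm (fromBlocks P R Rᵀ Q) (fromBlocks w 0 0 w')).PosSemidef)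
    (hτ : (herm τ (-w')).PosDef) (hd : ((Q + τ).map Complex.ofReal).PosDef)
    {x : ι → ℂ} (hx : herm (P - R * (Q + τ)⁻¹ * Rᵀ) w *ᵥ x = 0) :
    herm P w *ᵥ x = 0 := by
  have e : herm (fromBlocks P R Rᵀ Q) (fromBlocks w 0 0 w') +
      fromBlocks 0 0 0 (herm τ (-w')) =
      fromBlocks (herm P w) (R.map Complex.ofReal) (R.map Complex.ofReal)ᴴ
        ((Q + τ).map Complex.ofReal) := by
    rw [herm_fromBlocks, fromBlocks_add, herm_add, add_neg_cancel, herm_zero_right,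
      conjTranspose_map_ofReal]
    simp
  have : Invertible ((Q + τ).map Complex.ofReal) := hd.isUnit.invertible
  -- This completes `x` so that the square over the second block vanishes; only the Schur complement
  -- form at `x` remains, and it is zero.
  set y : κ → ℂ := -((((Q + τ).map Complex.ofReal)⁻¹ * (R.map Complex.ofReal)ᴴ) *ᵥ x) with hy
  have hz : star (Sum.elim x y) ⬝ᵥ ((herm (fromBlocks P R Rᵀ Q) (fromBlocks w 0 0 w') +
      fromBlocks 0 0 0 (herm τ (-w'))) *ᵥ (Sum.elim x y)) = 0 := by
    rw [e, dotProduct_mulVec, schur_complement_eq₂₂ _ _ _ _ hd.1, hy, add_neg_cancel]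
    have : herm P w - R.map Complex.ofReal * ((Q + τ).map Complex.ofReal)⁻¹ *
        (R.map Complex.ofReal)ᴴ = herm (P - R * (Q + τ)⁻¹ * Rᵀ) w := by
      rw [conjTranspose_map_ofReal, ← map_ofReal_inv, ← map_ofReal_mul, ← map_ofReal_mul,
        herm_sub_left]
    rw [this, ← dotProduct_mulVec, ← dotProduct_mulVec, hx]
    simp
  obtain ⟨h1, h2⟩ := mulVec_eq_zero_of_add h (posSemidef_fromBlocks_diagonal
    (PosSemidef.zero (n := ι) (R := ℂ)) hτ.posSemidef) hz
  have hy0 : y = 0 := by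
    refine mulVec_injective_of_posDef hτ y ?_
    rw [fromBlocks_mulVec] at h2
    ext i
    simpa using congrFun h2 (Sum.inr i)
  rw [hy0, herm_fromBlocks, fromBlocks_mulVec] at h1
  ext i
  simpa using congrFun h1 (Sum.inl i)

end Hermitian

/-! ### Local Gaussian maps preserve the scaled uncertainty inequalities -/

section LocalMaps

theorem J_mul_J : J * J = -1 := by
  ext i j
  fin_cases i <;> fin_cases j <;> simp [J]

theorem J_transpose : Jᵀ = -J := by
  ext i j
  fin_cases i <;> fin_cases j <;> simp [J]

theorem Omega_mul_Omega (k : ℕ) : Omega k * Omega k = -1 := by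
  ext ⟨i, a⟩ ⟨j, b⟩
  have h : ∀ c : Fin k, ∑ d, Omega k (i, a) (c, d) * Omega k (c, d) (j, b) =
      if i = c then (if c = j then (J * J) a b else 0) else 0 := by
    intro c
    by_cases h1 : i = c <;> by_cases h2 : c = j <;> simp [Omega, h1, h2, Matrix.mul_apply]
  rw [Matrix.mul_apply, Fintype.sum_prod_type, Finset.sum_congr rfl fun c _ => h c,
    Finset.sum_ite_eq, J_mul_J]
  by_cases h1 : i = j <;> by_cases h2 : a = b <;> simp [h1, h2]

theorem ancForm_mul_ancForm (d m : ℕ) : ancForm d m * ancForm d m = -1 := by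
  rw [ancForm, fromBlocks_multiply]
  simp [Omega_mul_Omega, ← fromBlocks_one, fromBlocks_neg]

theorem map_mulVec_injective {ι : Type} [Fintype ι] [DecidableEq ι] {w : Matrix ι ι ℝ}
    (h : w * w = -1) (x : ι → ℂ) (hx : w.map Complex.ofReal *ᵥ x = 0) : x = 0 := by
  have h1 : w.map Complex.ofReal * w.map Complex.ofReal = -1 := by
    rw [← map_ofReal_mul, h]
    ext i j
    by_cases e : i = j <;> simp [e]
  have h2 := congrArg (fun v => w.map Complex.ofReal *ᵥ v) hx
  simp only [mulVec_mulVec, h1, mulVec_zero, neg_mulVec, one_mulVec] at h2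
  exact neg_eq_zero.1 h2

theorem posDef_fromBlocks_diagonal {ι κ : Type} [Fintype ι] [Fintype κ] {A : Matrix ι ι ℂ}
    {D : Matrix κ κ ℂ} (hA : A.PosDef) (hD : D.PosDef) : (fromBlocks A 0 0 D).PosDef := by
  refine posDef_of_posSemidef (posSemidef_fromBlocks_diagonal hA.posSemidef hD.posSemidef)
    fun x hx => ?_
  rw [fromBlocks_mulVec] at hx
  have h1 := mulVec_injective_of_posDef hA (x ∘ Sum.inl) (by
    ext i
    simpa using congrFun hx (Sum.inl i))
  have h2 := mulVec_injective_of_posDef hD (x ∘ Sum.inr) (by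
    ext i
    simpa using congrFun hx (Sum.inr i))
  ext (i | i)
  · exact congrFun h1 i
  · exact congrFun h2 i

/-- The two-mode form `x J ⊕ y J`. -/
def twoForm (x y : ℝ) : Matrix (Fin 2 ⊕ Fin 2) (Fin 2 ⊕ Fin 2) ℝ :=
  fromBlocks (x • J) 0 0 (y • J)

variable (Ea Eb : GCP) (V : Matrix (Fin 2 ⊕ Fin 2) (Fin 2 ⊕ Fin 2) ℝ)

/-- The unitaries of Alice and Bob together. -/
def dilS : Matrix (Dilated Ea.d Ea.m ⊕ Dilated Eb.d Eb.m)
    (Dilated Ea.d Ea.m ⊕ Dilated Eb.d Eb.m) ℝ :=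
  fromBlocks Ea.S 0 0 Eb.S

/-- The correlation matrix of systems and ancillas before the unitaries. -/
def inputCM : Matrix (Dilated Ea.d Ea.m ⊕ Dilated Eb.d Eb.m)
    (Dilated Ea.d Ea.m ⊕ Dilated Eb.d Eb.m) ℝ :=
  (fromBlocks V 0 0 (fromBlocks Ea.σ 0 0 Eb.σ)).submatrix
    (Equiv.sumSumSumComm _ _ _ _) (Equiv.sumSumSumComm _ _ _ _)

/-- The form `x ω_a ⊕ y ω_b` on the dilated phase space. -/
def dilTwoForm (x y : ℝ) : Matrix (Dilated Ea.d Ea.m ⊕ Dilated Eb.d Eb.m)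
    (Dilated Ea.d Ea.m ⊕ Dilated Eb.d Eb.m) ℝ :=
  fromBlocks (x • dilForm Ea.d Ea.m) 0 0 (y • dilForm Eb.d Eb.m)

/-- Regrouping coordinates as systems against ancillas makes the input block diagonal, so that its
positivity follows blockwise. -/
theorem dilatedCM_eq : dilatedCM Ea Eb V = dilS Ea Eb * inputCM Ea Eb V * (dilS Ea Eb)ᵀ := by
  have : inputCM Ea Eb V =
      fromBlocks (fromBlocks V.toBlocks₁₁ 0 0 Ea.σ) (fromBlocks V.toBlocks₁₂ 0 0 0)
        (fromBlocks V.toBlocks₂₁ 0 0 0) (fromBlocks V.toBlocks₂₂ 0 0 Eb.σ) := by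
    ext ((i | i) | (i | i)) ((j | j) | (j | j)) <;> rfl
  rw [this]
  rfl

theorem dilTwoForm_eq (x y : ℝ) : dilTwoForm Ea Eb x y =
    (fromBlocks (twoForm x y) 0 0
      (fromBlocks (x • ancForm Ea.d Ea.m) 0 0 (y • ancForm Eb.d Eb.m))).submatrix
    (Equiv.sumSumSumComm _ _ _ _) (Equiv.sumSumSumComm _ _ _ _) := by
  ext ((i | i) | (i | i)) ((j | j) | (j | j)) <;> simp [dilTwoForm, twoForm, dilForm]

/-- Locality enters here: each party preserves its own form, so the two forms may be scaled
independently. -/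
theorem dilS_dilTwoForm (x y : ℝ) :
    dilS Ea Eb * dilTwoForm Ea Eb x y * (dilS Ea Eb)ᵀ = dilTwoForm Ea Eb x y := by
  have ha : Ea.S * dilForm Ea.d Ea.m * Ea.Sᵀ = dilForm Ea.d Ea.m := Ea.S_symplectic
  have hb : Eb.S * dilForm Eb.d Eb.m * Eb.Sᵀ = dilForm Eb.d Eb.m := Eb.S_symplectic
  rw [dilS, dilTwoForm, fromBlocks_transpose, fromBlocks_multiply, fromBlocks_multiply]
  simp [ha, hb]

theorem herm_inputCM (x y : ℝ) : herm (inputCM Ea Eb V) (dilTwoForm Ea Eb x y) =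
    (fromBlocks (herm V (twoForm x y)) 0 0
      (fromBlocks (herm Ea.σ (x • ancForm Ea.d Ea.m)) 0 0
        (herm Eb.σ (y • ancForm Eb.d Eb.m)))).submatrix
    (Equiv.sumSumSumComm _ _ _ _) (Equiv.sumSumSumComm _ _ _ _) := by
  rw [inputCM, dilTwoForm_eq, ← herm_submatrix, herm_fromBlocks_diagonal,
    herm_fromBlocks_diagonal]

theorem posSemidef_inputCM {x y : ℝ} (hx : |x| ≤ 1) (hy : |y| ≤ 1)
    (h : (herm V (twoForm x y)).PosSemidef) :
    (herm (inputCM Ea Eb V) (dilTwoForm Ea Eb x y)).PosSemidef := by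
  rw [herm_inputCM]
  exact (posSemidef_fromBlocks_diagonal h (posSemidef_fromBlocks_diagonal
    (posSemidef_herm_smul Ea.σ_cm.2 hx) (posSemidef_herm_smul Eb.σ_cm.2 hy))).submatrix _

theorem posSemidef_dilatedCM {x y : ℝ} (hx : |x| ≤ 1) (hy : |y| ≤ 1)
    (h : (herm V (twoForm x y)).PosSemidef) :
    (herm (dilatedCM Ea Eb V) (dilTwoForm Ea Eb x y)).PosSemidef := by
  have := posSemidef_herm_congr (posSemidef_inputCM Ea Eb V hx hy h) (dilS Ea Eb)
  rwa [dilS_dilTwoForm, ← dilatedCM_eq] at this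

theorem dilatedCM_transpose (hV : Vᵀ = V) : (dilatedCM Ea Eb V)ᵀ = dilatedCM Ea Eb V := by
  have h : (inputCM Ea Eb V)ᵀ = inputCM Ea Eb V := by
    have ha : Ea.σᵀ = Ea.σ := Ea.σ_cm.1
    have hb : Eb.σᵀ = Eb.σ := Eb.σ_cm.1
    rw [inputCM, transpose_submatrix, fromBlocks_transpose, fromBlocks_transpose, hV, ha, hb]
    simp
  rw [dilatedCM_eq, transpose_mul, transpose_mul, transpose_transpose, h, Matrix.mul_assoc]

/-- The form `x Ω ⊕ y Ω` on the measured modes. -/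
def measForm (x y : ℝ) : Matrix (Modes Ea.m ⊕ Modes Eb.m) (Modes Ea.m ⊕ Modes Eb.m) ℝ :=
  fromBlocks (x • Omega Ea.m) 0 0 (y • Omega Eb.m)

theorem dilTwoForm_submatrix (x y : ℝ) :
    (dilTwoForm Ea Eb x y).submatrix (Sum.elim (outIdx Ea Eb) (measIdx Ea Eb))
      (Sum.elim (outIdx Ea Eb) (measIdx Ea Eb)) =
    fromBlocks (twoForm x y) 0 0 (measForm Ea Eb x y) := by
  ext ((i | i) | (i | i)) ((j | j) | (j | j)) <;>
    simp [dilTwoForm, twoForm, dilForm, measForm, outIdx, measIdx, ancForm]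

theorem posSemidef_joint {x y : ℝ} (hx : |x| ≤ 1) (hy : |y| ≤ 1) (hV : Vᵀ = V)
    (h : (herm V (twoForm x y)).PosSemidef) :
    (herm (fromBlocks ((dilatedCM Ea Eb V).submatrix (outIdx Ea Eb) (outIdx Ea Eb))
      ((dilatedCM Ea Eb V).submatrix (outIdx Ea Eb) (measIdx Ea Eb))
      ((dilatedCM Ea Eb V).submatrix (outIdx Ea Eb) (measIdx Ea Eb))ᵀ
      ((dilatedCM Ea Eb V).submatrix (measIdx Ea Eb) (measIdx Ea Eb)))
      (fromBlocks (twoForm x y) 0 0 (measForm Ea Eb x y))).PosSemidef := by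
  rw [← dilTwoForm_submatrix, transpose_submatrix, dilatedCM_transpose _ _ _ hV]
  have := (posSemidef_dilatedCM Ea Eb V hx hy h).submatrix
    (Sum.elim (outIdx Ea Eb) (measIdx Ea Eb))
  rw [herm_submatrix] at this
  convert! this using 2
  ext (i | i) (j | j) <;> rfl

theorem posSemidef_measured {x y : ℝ} (hx : |x| ≤ 1) (hy : |y| ≤ 1) :
    (herm (fromBlocks Ea.τ 0 0 Eb.τ) (-measForm Ea Eb x y)).PosSemidef := by
  refine posSemidef_herm_neg ?_
  rw [measForm, herm_fromBlocks_diagonal]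
  exact posSemidef_fromBlocks_diagonal (posSemidef_herm_smul Ea.τ_cm.2 hx)
    (posSemidef_herm_smul Eb.τ_cm.2 hy)

theorem posDef_measured {x y : ℝ} (hx : |x| < 1) (hy : |y| < 1) :
    (herm (fromBlocks Ea.τ 0 0 Eb.τ) (-measForm Ea Eb x y)).PosDef := by
  have e : -measForm Ea Eb x y = measForm Ea Eb (-x) (-y) := by
    simp [measForm, fromBlocks_neg]
  rw [e, measForm, herm_fromBlocks_diagonal]
  refine posDef_fromBlocks_diagonal
    (posDef_herm_smul Ea.τ_cm.2 (map_mulVec_injective (Omega_mul_Omega _)) (by rwa [abs_neg]))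
    (posDef_herm_smul Eb.τ_cm.2 (map_mulVec_injective (Omega_mul_Omega _)) (by rwa [abs_neg]))

theorem posDef_measured_add {x y : ℝ} (hx : |x| ≤ 1) (hy : |y| ≤ 1)
    (h : (herm V (twoForm x y)).PosSemidef) :
    (((dilatedCM Ea Eb V).submatrix (measIdx Ea Eb) (measIdx Ea Eb) +
      fromBlocks Ea.τ 0 0 Eb.τ).map Complex.ofReal).PosDef := by
  -- Scaling by `t = 0` removes the form and leaves the real correlation matrix.
  have h1 := (posSemidef_herm_smul (posSemidef_dilatedCM Ea Eb V hx hy h)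
    (t := 0) (by simp)).submatrix (measIdx Ea Eb)
  have h2 := posDef_measured Ea Eb (x := 0) (y := 0) (by simp) (by simp)
  have e : -measForm Ea Eb 0 0 = 0 := by simp [measForm]
  rw [e, herm_zero_right] at h2
  rw [zero_smul, herm_zero_right] at h1
  have h3 := PosDef.posSemidef_add h1 h2
  convert! h3 using 1
  ext i j
  simp

/-- A local Gaussian map preserves `V + i (x J ⊕ y J) ≥ 0` for `|x|, |y| ≤ 1`. -/
theorem posSemidef_applyLocal {x y : ℝ} (hx : |x| ≤ 1) (hy : |y| ≤ 1) (hV : Vᵀ = V)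
    (h : (herm V (twoForm x y)).PosSemidef) :
    (herm (applyLocal Ea Eb V) (twoForm x y)).PosSemidef := by
  have := posSemidef_herm_schur (posSemidef_joint Ea Eb V hx hy hV h)
    (posSemidef_measured Ea Eb hx hy) (posDef_measured_add Ea Eb V hx hy h)
  rwa [transpose_submatrix, dilatedCM_transpose _ _ _ hV] at this

/-- The rows of the output modes of a symplectic matrix that does not couple them to the
ancillas. -/
theorem dilated_decoupled {d m : ℕ} {S : Matrix (Dilated d m) (Dilated d m) ℝ}
    (hS : IsSymplectic (dilForm d m) S) (h : S.toBlocks₁₂ = 0) :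
    IsSymplectic J S.toBlocks₁₁ ∧ S.toBlocks₂₁ = 0 := by
  have e : S = fromBlocks S.toBlocks₁₁ 0 S.toBlocks₂₁ S.toBlocks₂₂ := by
    rw [← h, fromBlocks_toBlocks]
  have hS' : S * dilForm d m * Sᵀ = dilForm d m := hS
  rw [e, dilForm, fromBlocks_transpose, fromBlocks_multiply, fromBlocks_multiply,
    fromBlocks_inj] at hS'
  simp only [Matrix.zero_mul, Matrix.mul_zero, add_zero, transpose_zero, zero_add] at hS'
  obtain ⟨h1, h2, -, -⟩ := hS'
  refine ⟨h1, ?_⟩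
  -- The off-diagonal block of the symplectic relation is `S₁₁ J S₂₁ᵀ = 0`, and `S₁₁ J` is
  -- invertible.
  have h3 : (S.toBlocks₁₁ * J) * (S.toBlocks₁₁ᵀ * (-J)) = 1 := by
    rw [← Matrix.mul_assoc, h1, Matrix.mul_neg, J_mul_J, neg_neg]
  have h4 := mul_eq_one_comm.1 h3
  have h5 : (S.toBlocks₂₁)ᵀ = 0 := by
    calc (S.toBlocks₂₁)ᵀ = (S.toBlocks₁₁ᵀ * (-J)) * (S.toBlocks₁₁ * J) * (S.toBlocks₂₁)ᵀ := by
          rw [h4, Matrix.one_mul]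
      _ = 0 := by rw [Matrix.mul_assoc, h2, Matrix.mul_zero]
  exact transpose_eq_zero.1 h5

/-- With both off-diagonal blocks of each `S` zero, outputs and measured modes are uncorrelated. The
measurement correction vanishes whatever the inverse is, hence for every real `U`. -/
theorem applyLocal_of_decoupled (ha : Ea.S.toBlocks₁₂ = 0) (hb : Eb.S.toBlocks₁₂ = 0)
    (U : Matrix (Fin 2 ⊕ Fin 2) (Fin 2 ⊕ Fin 2) ℝ) :
    applyLocal Ea Eb U = localAct Ea.S.toBlocks₁₁ Eb.S.toBlocks₁₁ 0 0 U := by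
  obtain ⟨-, ha'⟩ := dilated_decoupled Ea.S_symplectic ha
  obtain ⟨-, hb'⟩ := dilated_decoupled Eb.S_symplectic hb
  have ea : Ea.S = fromBlocks Ea.S.toBlocks₁₁ 0 0 Ea.S.toBlocks₂₂ := by
    rw [← ha, ← ha', ha]
    nth_rw 1 [← fromBlocks_toBlocks Ea.S, ha]
  have eb : Eb.S = fromBlocks Eb.S.toBlocks₁₁ 0 0 Eb.S.toBlocks₂₂ := by
    rw [← hb, ← hb', hb]
    nth_rw 1 [← fromBlocks_toBlocks Eb.S, hb]
  have eM : dilatedCM Ea Eb U = fromBlocks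
      (fromBlocks (Ea.S.toBlocks₁₁ * U.toBlocks₁₁ * Ea.S.toBlocks₁₁ᵀ) 0 0
        (Ea.S.toBlocks₂₂ * Ea.σ * Ea.S.toBlocks₂₂ᵀ))
      (fromBlocks (Ea.S.toBlocks₁₁ * U.toBlocks₁₂ * Eb.S.toBlocks₁₁ᵀ) 0 0 0)
      (fromBlocks (Eb.S.toBlocks₁₁ * U.toBlocks₂₁ * Ea.S.toBlocks₁₁ᵀ) 0 0 0)
      (fromBlocks (Eb.S.toBlocks₁₁ * U.toBlocks₂₂ * Eb.S.toBlocks₁₁ᵀ) 0 0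
        (Eb.S.toBlocks₂₂ * Eb.σ * Eb.S.toBlocks₂₂ᵀ)) := by
    rw [dilatedCM]
    rw [ea, eb]
    simp only [toBlocks_fromBlocks₁₁, toBlocks_fromBlocks₂₂, fromBlocks_transpose,
      fromBlocks_multiply, Matrix.zero_mul, Matrix.mul_zero, add_zero, transpose_zero, zero_add]
  have eR : (dilatedCM Ea Eb U).submatrix (outIdx Ea Eb) (measIdx Ea Eb) = 0 := by
    rw [eM]
    ext (i | i) (j | j) <;> simp [outIdx, measIdx]
  rw [applyLocal]
  simp only [eR, Matrix.zero_mul, sub_zero]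
  rw [eM, localAct, ← fromBlocks_toBlocks U]
  simp only [toBlocks_fromBlocks₁₁, toBlocks_fromBlocks₁₂, toBlocks_fromBlocks₂₁,
    toBlocks_fromBlocks₂₂, fromBlocks_transpose, fromBlocks_multiply, Matrix.zero_mul,
    Matrix.mul_zero, add_zero, transpose_zero, zero_add, fromBlocks_zero]
  ext (i | i) (j | j) <;> simp [outIdx]

/-- If `V' + i (x J ⊕ y J)` has a null vector whose local components are not proportional to real
vectors, then the local map producing `V'` does not couple the output modes to the ancillas. -/
theorem decoupled_of_null {x y : ℝ} (hx : |x| < 1) (hy : |y| < 1) (hV : Vᵀ = V)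
    (h : (herm V (twoForm x y)).PosSemidef) {z : Fin 2 ⊕ Fin 2 → ℂ}
    (hz : herm (applyLocal Ea Eb V) (twoForm x y) *ᵥ z = 0) {s t : ℝ} (hs : s ≠ 0) (ht : t ≠ 0)
    (ha0 : z (.inl 0) = 1) (ha1 : z (.inl 1) = Complex.I * s)
    (hb0 : z (.inr 0) = 1) (hb1 : z (.inr 1) = Complex.I * t) :
    Ea.S.toBlocks₁₂ = 0 ∧ Eb.S.toBlocks₁₂ = 0 := by
  have h1 : herm ((dilatedCM Ea Eb V).submatrix (outIdx Ea Eb) (outIdx Ea Eb)) (twoForm x y) *ᵥ z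
      = 0 := by
    refine exists_null_of_schur (posSemidef_joint Ea Eb V hx.le hy.le hV h)
      (posDef_measured Ea Eb hx hy) (posDef_measured_add Ea Eb V hx.le hy.le h) ?_
    rw [transpose_submatrix, dilatedCM_transpose _ _ _ hV]
    exact hz
  set So := (dilS Ea Eb).submatrix (outIdx Ea Eb) id with hSo
  have e1 : (dilatedCM Ea Eb V).submatrix (outIdx Ea Eb) (outIdx Ea Eb) =
      So * inputCM Ea Eb V * Soᵀ := by
    rw [dilatedCM_eq]; rfl
  have e2 : twoForm x y = So * dilTwoForm Ea Eb x y * Soᵀ := by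
    have : (dilTwoForm Ea Eb x y).submatrix (outIdx Ea Eb) (outIdx Ea Eb) = twoForm x y := by
      ext (i | i) (j | j) <;> simp [dilTwoForm, twoForm, dilForm, outIdx]
    rw [← this]
    nth_rw 1 [← dilS_dilTwoForm]
    rfl
  rw [e1, e2, ← herm_congr] at h1
  set K := herm (inputCM Ea Eb V) (dilTwoForm Ea Eb x y) with hK
  -- Pulled back through the unitaries, `z` is a null vector of the block-diagonal input form. The
  -- ancilla blocks are positive definite because `|x|, |y| < 1`, so the ancillary components of `v`
  -- vanish.
  set v := (So.map Complex.ofReal)ᴴ *ᵥ z with hv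
  have hKv : K *ᵥ v = 0 := by
    rw [← (posSemidef_inputCM Ea Eb V hx.le hy.le h).dotProduct_mulVec_zero_iff, hv, star_mulVec,
      conjTranspose_conjTranspose, ← dotProduct_mulVec, mulVec_mulVec, mulVec_mulVec,
      h1, dotProduct_zero]
  rw [hK, herm_inputCM] at hKv
  have va := mulVec_injective_of_posDef
    (posDef_herm_smul Ea.σ_cm.2 (map_mulVec_injective (ancForm_mul_ancForm _ _)) hx)
    (fun k => v (.inl (.inr k))) (by
      ext k
      have := congrFun hKv (.inl (.inr k))
      simpa [mulVec, dotProduct, Fintype.sum_sum_type] using this)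
  have vb := mulVec_injective_of_posDef
    (posDef_herm_smul Eb.σ_cm.2 (map_mulVec_injective (ancForm_mul_ancForm _ _)) hy)
    (fun k => v (.inr (.inr k))) (by
      ext k
      have := congrFun hKv (.inr (.inr k))
      simpa [mulVec, dotProduct, Fintype.sum_sum_type] using this)
  -- The component of `v` at an ancilla coordinate `k` is `S₀ₖ + i s S₁ₖ` for Alice and `S₀ₖ + i t
  -- S₁ₖ` for Bob. With `s, t ≠ 0`, real and imaginary parts kill both entries.
  constructor
  · ext j k
    have := congrFun va k
    simp only [hv, hSo, mulVec, dotProduct, Fintype.sum_sum_type, conjTranspose_apply,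
      Fin.sum_univ_two, ha0, ha1, hb0, hb1, dilS, outIdx] at this
    simp [Complex.ext_iff, hs] at this
    fin_cases j
    · exact this.1
    · exact this.2
  · ext j k
    have := congrFun vb k
    simp only [hv, hSo, mulVec, dotProduct, Fintype.sum_sum_type, conjTranspose_apply,
      Fin.sum_univ_two, ha0, ha1, hb0, hb1, dilS, outIdx] at this
    simp [Complex.ext_iff, ht] at this
    fin_cases j
    · exact this.1
    · exact this.2

end LocalMaps

/-! ### From an uncertainty inequality to a fidelity bound -/

section Fidelity

/-- The rows `(Z I)` that combine the two shared modes into the noise. -/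
def noiseRow : Matrix (Fin 2) (Fin 2 ⊕ Fin 2) ℝ := fromCols Z (1 : Matrix (Fin 2) (Fin 2) ℝ)

theorem noise_eq (V : Matrix (Fin 2 ⊕ Fin 2) (Fin 2 ⊕ Fin 2) ℝ) :
    noise V = noiseRow * V * noiseRowᵀ := by
  have hZ : Zᵀ = Z := by
    ext i j
    fin_cases i <;> fin_cases j <;> simp [Z]
  conv_rhs => rw [← fromBlocks_toBlocks V]
  rw [noiseRow, fromCols_mul_fromBlocks, transpose_fromCols, fromCols_mul_fromRows, noise, hZ]
  simp only [Matrix.one_mul, transpose_one, Matrix.mul_one, Matrix.add_mul]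
  abel

/-- Conjugation by `Z` reverses `J`, so Alice's coefficient enters with a minus sign. -/
theorem noiseRow_twoForm (x y : ℝ) :
    noiseRow * twoForm x y * noiseRowᵀ = (y - x) • J := by
  rw [← noise_eq]
  ext i j
  fin_cases i <;> fin_cases j <;> simp [noise, twoForm, Z, J] <;> ring

theorem two_by_two_bounds {N : Matrix (Fin 2) (Fin 2) ℝ} {c : ℝ}
    (h : (herm N (c • J)).PosSemidef) :
    0 ≤ N 0 0 ∧ 0 ≤ N 1 1 ∧ N 1 0 = N 0 1 ∧ c ^ 2 ≤ N 0 0 * N 1 1 - N 0 1 ^ 2 := by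
  have h0 := h.diag_nonneg (i := 0)
  have h1 := h.diag_nonneg (i := 1)
  have hs := congrFun (congrFun h.1 0) 1
  have hd := h.det_nonneg
  rw [det_fin_two] at hd
  simp [herm_apply, J, conjTranspose_apply] at h0 h1 hd hs
  have hs' : N 1 0 = N 0 1 := by
    exact_mod_cast hs
  refine ⟨h0, h1, hs', ?_⟩
  have hd' := (Complex.le_def.1 hd).1
  simp [hs'] at hd'
  nlinarith

/-- With `c = y - x`, `det N ≥ c²` gives `tr N ≥ 2c`, so `det (2 + N) = 4 + 2 tr N + det N ≥ (2 +
c)²`. Equality forces both estimates to be sharp; then `(N₀₀ - N₁₁)² + 4 N₀₁² = (tr N)² - 4 det N =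
0`. -/
theorem fidelity_bound {V : Matrix (Fin 2 ⊕ Fin 2) (Fin 2 ⊕ Fin 2) ℝ} {x y : ℝ} (hxy : 0 ≤ y - x)
    (h : (herm V (twoForm x y)).PosSemidef) :
    fidelity V ≤ 2 / (2 + (y - x)) ∧
      (fidelity V = 2 / (2 + (y - x)) → noise V = (y - x) • (1 : Matrix (Fin 2) (Fin 2) ℝ)) := by
  have hN := posSemidef_herm_congr h noiseRow
  rw [noiseRow_twoForm, ← noise_eq] at hN
  set c := y - x
  set N := noise V with hNdef
  obtain ⟨h0, h1, hs, hd⟩ := two_by_two_bounds hN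
  have htr : 2 * c ≤ N 0 0 + N 1 1 := by
    refine abs_le_of_sq_le_sq' ?_ (by linarith) |>.2
    nlinarith [sq_nonneg (N 0 0 - N 1 1), sq_nonneg (N 0 1)]
  have hdet : ((2 : ℝ) • (1 : Matrix (Fin 2) (Fin 2) ℝ) + N).det =
      4 + 2 * (N 0 0 + N 1 1) + (N 0 0 * N 1 1 - N 0 1 ^ 2) := by
    rw [det_fin_two]
    simp [hs]
    ring
  have hle : (2 + c) ^ 2 ≤ ((2 : ℝ) • (1 : Matrix (Fin 2) (Fin 2) ℝ) + N).det := by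
    rw [hdet]; nlinarith
  have hsq : 2 + c ≤ √((2 : ℝ) • (1 : Matrix (Fin 2) (Fin 2) ℝ) + N).det :=
    Real.le_sqrt_of_sq_le hle
  refine ⟨?_, fun hF => ?_⟩
  · exact div_le_div_of_nonneg_left (by norm_num) (by linarith) hsq
  · have hpos : 0 < √((2 : ℝ) • (1 : Matrix (Fin 2) (Fin 2) ℝ) + N).det := by linarith
    have e1 : √((2 : ℝ) • (1 : Matrix (Fin 2) (Fin 2) ℝ) + N).det = 2 + c := by
      rw [fidelity, div_eq_div_iff hpos.ne' (by linarith)] at hF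
      linarith
    have e2 : ((2 : ℝ) • (1 : Matrix (Fin 2) (Fin 2) ℝ) + N).det = (2 + c) ^ 2 := by
      rw [← e1, Real.sq_sqrt]
      exact (sq_nonneg _).trans hle
    rw [hdet] at e2
    have e3 : N 0 0 + N 1 1 = 2 * c := by nlinarith
    have e4 : N 0 0 * N 1 1 - N 0 1 ^ 2 = c ^ 2 := by nlinarith
    have e5 : (N 0 0 - N 1 1) ^ 2 + 4 * N 0 1 ^ 2 = 0 := by
      have : (N 0 0 + N 1 1) ^ 2 = 4 * c ^ 2 := by rw [e3]; ring
      nlinarith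
    have e6 : N 0 1 = 0 := by
      have : N 0 1 ^ 2 = 0 := by nlinarith [sq_nonneg (N 0 0 - N 1 1), sq_nonneg (N 0 1)]
      exact pow_eq_zero_iff (two_ne_zero) |>.1 this
    have e7 : N 0 0 - N 1 1 = 0 := by
      have : (N 0 0 - N 1 1) ^ 2 = 0 := by
        nlinarith [sq_nonneg (N 0 0 - N 1 1), sq_nonneg (N 0 1)]
      exact pow_eq_zero_iff (two_ne_zero) |>.1 this
    ext i j
    fin_cases i <;> fin_cases j <;> simp [hs, e6] <;> linarith

/-- The vector `(1, i)` is null for `I + i J`. Its pullback by `(Z I)` has zero quadratic form, and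
semidefiniteness makes it a null vector. -/
theorem exists_null_of_noise {V : Matrix (Fin 2 ⊕ Fin 2) (Fin 2 ⊕ Fin 2) ℝ} {x y : ℝ}
    (h : (herm V (twoForm x y)).PosSemidef)
    (hN : noise V = (y - x) • (1 : Matrix (Fin 2) (Fin 2) ℝ)) :
    herm V (twoForm x y) *ᵥ (Sum.elim ![1, -Complex.I] ![1, Complex.I]) = 0 := by
  have e : (Sum.elim ![1, -Complex.I] ![1, Complex.I] : Fin 2 ⊕ Fin 2 → ℂ) =
      (noiseRow.map Complex.ofReal)ᴴ *ᵥ ![1, Complex.I] := by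
    ext (i | i) <;> fin_cases i <;>
      simp [mulVec, dotProduct, noiseRow, Z, conjTranspose_apply]
  have h1 := herm_congr noiseRow V (twoForm x y)
  rw [noiseRow_twoForm, ← noise_eq, hN, ← smul_herm] at h1
  have h2 : herm 1 J *ᵥ ![1, Complex.I] = 0 := by
    ext i
    fin_cases i <;> simp [mulVec, dotProduct, herm_apply, J]
  rw [← h.dotProduct_mulVec_zero_iff, e, star_mulVec,
    conjTranspose_conjTranspose, ← dotProduct_mulVec, mulVec_mulVec, mulVec_mulVec, h1,
    smul_mulVec, h2, smul_zero, dotProduct_zero]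

end Fidelity

/-! ### Williamson's normal form for two modes -/

section Williamson

/-- Indices of the phase space of two modes. -/
abbrev TwoModes : Type := Fin 2 ⊕ Fin 2

open scoped MatrixOrder in
theorem exists_eq_mul_transpose {V : Matrix TwoModes TwoModes ℝ} (hV : V.PosDef) :
    ∃ L : Matrix TwoModes TwoModes ℝ, V = L * Lᵀ ∧ IsUnit L.det := by
  have h0 : 0 ≤ V := hV.posSemidef.nonneg
  have h1 : CFC.sqrt V * CFC.sqrt V = V := CFC.sqrt_mul_sqrt_self V h0
  have h2 : (CFC.sqrt V)ᵀ = CFC.sqrt V := (CFC.sqrt_nonneg V).posSemidef.1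
  refine ⟨CFC.sqrt V, by rw [h2, h1], ?_⟩
  have h3 : IsUnit (CFC.sqrt V * CFC.sqrt V).det := by
    rw [h1]
    exact (isUnit_iff_isUnit_det _).1 hV.isUnit
  rw [det_mul] at h3
  exact isUnit_of_mul_isUnit_left h3

theorem exists_orthogonal_extension {e₁ e₂ : TwoModes → ℝ} (h₁ : e₁ ⬝ᵥ e₁ = 1)
    (h₂ : e₂ ⬝ᵥ e₂ = 1) (h₁₂ : e₁ ⬝ᵥ e₂ = 0) :
    ∃ O : Matrix TwoModes TwoModes ℝ, O * Oᵀ = 1 ∧ O (.inl 0) = e₁ ∧ O (.inl 1) = e₂ := by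
  let v : TwoModes → EuclideanSpace ℝ TwoModes :=
    Sum.elim ![WithLp.toLp 2 e₁, WithLp.toLp 2 e₂] 0
  have hv : Orthonormal ℝ ((Set.range Sum.inl : Set TwoModes).domRestrict v) := by
    rw [orthonormal_iff_ite]
    rintro ⟨_, i, rfl⟩ ⟨_, j, rfl⟩
    rw [EuclideanSpace.inner_eq_star_dotProduct]
    fin_cases i <;> fin_cases j <;>
      simp [v, h₁, h₂, h₁₂, dotProduct_comm e₂ e₁]
  obtain ⟨b, hb⟩ := hv.exists_orthonormalBasis_extension_of_card_eq (by simp)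
  refine ⟨Matrix.of fun i => WithLp.ofLp (b i), ?_, ?_, ?_⟩
  · ext i j
    have := orthonormal_iff_ite.1 b.orthonormal j i
    rw [EuclideanSpace.inner_eq_star_dotProduct] at this
    simp only [Matrix.mul_apply, transpose_apply, Matrix.one_apply]
    simpa [dotProduct, eq_comm] using this
  · ext k
    simp [hb (.inl 0) ⟨0, rfl⟩, v]
  · ext k
    simp [hb (.inl 1) ⟨1, rfl⟩, v]

theorem antisymm_dotProduct {ι : Type} [Fintype ι] {K : Matrix ι ι ℝ} (hK : Kᵀ = -K)
    (x y : ι → ℝ) : x ⬝ᵥ (K *ᵥ y) = -((K *ᵥ x) ⬝ᵥ y) := by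
  rw [dotProduct_mulVec, ← mulVec_transpose, hK, neg_mulVec, neg_dotProduct]

theorem det_J : J.det = 1 := by simp [J, det_fin_two]

/-- The normal form of a nondegenerate antisymmetric `4 × 4` matrix. -/
theorem exists_antisymm_normalForm {K : Matrix TwoModes TwoModes ℝ} (hK : Kᵀ = -K)
    (hdet : K.det ≠ 0) :
    ∃ (O : Matrix TwoModes TwoModes ℝ) (p q : ℝ), O * Oᵀ = 1 ∧ 0 < p ∧ 0 < q ∧
      O * K * Oᵀ = twoForm p q := by
  have hH : (K * K).IsHermitian := by
    rw [IsHermitian, conjTranspose_eq_transpose_of_trivial, transpose_mul, hK, neg_mul_neg]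
  -- An eigenvector `v` of the symmetric matrix `K²` spans, together with `K v`, a plane invariant
  -- under `K`; the eigenvalue is `-p²`.
  set v : TwoModes → ℝ := WithLp.ofLp (hH.eigenvectorBasis (.inl 0)) with hv
  set l := hH.eigenvalues (.inl 0)
  have hKK : K *ᵥ (K *ᵥ v) = l • v := by
    rw [mulVec_mulVec]
    exact hH.mulVec_eigenvectorBasis (.inl 0)
  have hvv : v ⬝ᵥ v = 1 := by
    have := orthonormal_iff_ite.1 hH.eigenvectorBasis.orthonormal (.inl 0) (.inl 0)
    rw [EuclideanSpace.inner_eq_star_dotProduct] at this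
    simpa using this
  have huu : (K *ᵥ v) ⬝ᵥ (K *ᵥ v) = -l := by
    rw [antisymm_dotProduct hK, hKK, smul_dotProduct, hvv]
    simp
  have hvu : v ⬝ᵥ (K *ᵥ v) = 0 := by
    have := antisymm_dotProduct hK v v
    rw [dotProduct_comm (K *ᵥ v) v] at this
    linarith
  have hl : 0 < -l := by
    rw [← huu]
    refine lt_of_le_of_ne (dotProduct_self_star_nonneg (K *ᵥ v)) fun h => ?_
    have h0 : K *ᵥ v = 0 := dotProduct_self_eq_zero.1 h.symm
    have : v = 0 := eq_zero_of_mulVec_eq_zero hdet h0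
    rw [this] at hvv
    simp at hvv
  set p := √(-l) with hp
  have hp0 : 0 < p := Real.sqrt_pos.2 hl
  have hpp : p * p = -l := Real.mul_self_sqrt hl.le
  obtain ⟨O, hO, hO1, hO2⟩ := exists_orthogonal_extension (e₁ := v) (e₂ := -(p⁻¹ • (K *ᵥ v))) hvv
    (by
      rw [neg_dotProduct_neg, smul_dotProduct, dotProduct_smul, huu, ← hpp]
      simp only [smul_eq_mul]
      field_simp)
    (by rw [dotProduct_neg, dotProduct_smul, hvu]; simp)
  have hoo : ∀ i j, O i ⬝ᵥ O j = if i = j then 1 else 0 := by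
    intro i j
    have := congrFun (congrFun hO i) j
    rw [Matrix.one_apply] at this
    rw [← this]
    simp [Matrix.mul_apply, dotProduct]
  have hM : ∀ i j, (O * K * Oᵀ) i j = O i ⬝ᵥ (K *ᵥ O j) := by
    intro i j
    rw [Matrix.mul_assoc, Matrix.mul_apply]
    rfl
  have hKv : K *ᵥ v = (-p) • O (.inl 1) := by
    rw [hO2, smul_neg, neg_smul, neg_neg, smul_smul, mul_inv_cancel₀ hp0.ne', one_smul]
  have hK1 : K *ᵥ O (.inl 1) = p • O (.inl 0) := by
    rw [hO2, mulVec_neg, mulVec_smul, hKK, hO1, smul_smul, ← neg_smul]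
    congr 1
    rw [eq_comm, ← mul_right_inj' hp0.ne', hpp]
    field_simp
  have hanti : ∀ i j, (O * K * Oᵀ) i j = -(O * K * Oᵀ) j i := by
    intro i j
    rw [hM, hM, antisymm_dotProduct hK, dotProduct_comm]
  have c0 : ∀ i, (O * K * Oᵀ) i (.inl 0) = if i = .inl 1 then -p else 0 := by
    intro i
    rw [hM, hO1, hKv, dotProduct_smul, hoo]
    by_cases h : i = .inl 1 <;> simp [h]
  have c1 : ∀ i, (O * K * Oᵀ) i (.inl 1) = if i = .inl 0 then p else 0 := by
    intro i
    rw [hM, hK1, dotProduct_smul, hoo]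
    by_cases h : i = .inl 0 <;> simp [h]
  set q := (O * K * Oᵀ) (.inr 0) (.inr 1) with hq
  have hform : O * K * Oᵀ = twoForm p q := by
    have d0 := hanti (.inr 0) (.inr 0)
    have d1 := hanti (.inr 1) (.inr 1)
    have d2 := hanti (.inr 1) (.inr 0)
    have r0 := fun j => hanti (.inl 0) j
    have r1 := fun j => hanti (.inl 1) j
    ext (i | i) (j | j) <;> fin_cases i <;> fin_cases j <;>
      simp [c0, c1, r0, r1, twoForm, J] <;> linarith
  have hdetO : O.det ≠ 0 := by
    intro h
    have := congrArg det hO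
    rw [det_mul, h] at this
    simp at this
  have hq0 : q ≠ 0 := by
    intro h
    have := congrArg det hform
    rw [det_mul, det_mul, det_transpose, twoForm, det_fromBlocks_zero₂₁, h] at this
    simp [hdetO, hdet] at this
  rcases lt_or_gt_of_ne hq0 with hneg | hpos
  -- Exchanging the last two coordinates is orthogonal and reverses the second `J`, which makes its
  -- coefficient positive.
  · set P : Matrix TwoModes TwoModes ℝ := fromBlocks 1 0 0 !![0, 1; 1, 0] with hP
    have hPt : Pᵀ = P := by
      rw [hP, fromBlocks_transpose]
      congr 1 <;> ext i j <;> fin_cases i <;> fin_cases j <;> simp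
    have hPP : P * P = 1 := by
      rw [hP, fromBlocks_multiply, ← fromBlocks_one]
      congr 1 <;> ext i j <;> fin_cases i <;> fin_cases j <;> simp
    refine ⟨P * O, p, -q, ?_, hp0, by linarith, ?_⟩
    · rw [transpose_mul, hPt, Matrix.mul_assoc, ← Matrix.mul_assoc O, hO, Matrix.one_mul, hPP]
    · have : P * O * K * (P * O)ᵀ = P * (O * K * Oᵀ) * P := by
        rw [transpose_mul, hPt]
        simp only [Matrix.mul_assoc]
      rw [this, hform, hP, twoForm, fromBlocks_multiply, fromBlocks_multiply, twoForm]
      congr 1 <;> ext i j <;> fin_cases i <;> fin_cases j <;> simp [J]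
  · exact ⟨O, p, q, hO, hp0, hpos, hform⟩

theorem det_JJ : JJ.det = 1 := by
  rw [JJ, det_fromBlocks_zero₂₁, det_J, one_mul]

theorem JJ_transpose : JJᵀ = -JJ := by
  simp [JJ, fromBlocks_transpose, J_transpose, fromBlocks_neg]

theorem JJ_mul_JJ : JJ * JJ = -1 := by
  simp [JJ, fromBlocks_multiply, J_mul_J, ← fromBlocks_one, fromBlocks_neg]

/-- Williamson's theorem for two modes. -/
theorem exists_williamson {V : Matrix TwoModes TwoModes ℝ} (hV : V.PosDef) :
    ∃ (T : Matrix TwoModes TwoModes ℝ) (a b : ℝ), IsSymplectic JJ T ∧ 0 < a ∧ 0 < b ∧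
      T * V * Tᵀ = fromBlocks (a • 1) 0 0 (b • 1) := by
  obtain ⟨L, rfl, hL⟩ := exists_eq_mul_transpose hV
  have hLi : L⁻¹ * L = 1 := nonsing_inv_mul _ hL
  have hLt : Lᵀ * (L⁻¹)ᵀ = 1 := by rw [← transpose_mul, hLi, transpose_one]
  -- For `V = L Lᵀ` and orthogonal `O`, the matrix `D O L⁻¹` takes `V` to `D²`. It is symplectic
  -- once `D` rescales the normal form of `L⁻¹ 𝒥 L⁻ᵀ` to `𝒥`, whence the entries `p^(-1/2)` and
  -- `q^(-1/2)`.
  obtain ⟨O, p, q, hO, hp, hq, hOK⟩ := exists_antisymm_normalForm (K := L⁻¹ * JJ * (L⁻¹)ᵀ)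
    (by
      rw [transpose_mul, transpose_mul, transpose_transpose, JJ_transpose, Matrix.neg_mul,
        Matrix.mul_neg, Matrix.mul_assoc])
    (by
      rw [det_mul, det_mul, det_transpose, det_JJ, mul_one]
      have : L⁻¹.det ≠ 0 := by
        have := congrArg det hLi
        rw [det_mul, det_one] at this
        exact left_ne_zero_of_mul_eq_one this
      exact mul_ne_zero this this)
  set D : Matrix TwoModes TwoModes ℝ := fromBlocks ((√p)⁻¹ • 1) 0 0 ((√q)⁻¹ • 1) with hD
  have hDt : Dᵀ = D := by simp [hD, fromBlocks_transpose]
  have sp' : (√p)⁻¹ * p * (√p)⁻¹ = 1 := by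
    have := Real.mul_self_sqrt hp.le
    have := (Real.sqrt_pos.2 hp).ne'
    field_simp
    linarith
  have sp : (√p)⁻¹ * (√p)⁻¹ = p⁻¹ := by rw [← mul_inv, Real.mul_self_sqrt hp.le]
  have sq' : (√q)⁻¹ * q * (√q)⁻¹ = 1 := by
    have := Real.mul_self_sqrt hq.le
    have := (Real.sqrt_pos.2 hq).ne'
    field_simp
    linarith
  have sq : (√q)⁻¹ * (√q)⁻¹ = q⁻¹ := by rw [← mul_inv, Real.mul_self_sqrt hq.le]
  refine ⟨D * O * L⁻¹, p⁻¹, q⁻¹, ?_, inv_pos.2 hp, inv_pos.2 hq, ?_⟩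
  · have : D * O * L⁻¹ * JJ * (D * O * L⁻¹)ᵀ = D * (O * (L⁻¹ * JJ * (L⁻¹)ᵀ) * Oᵀ) * D := by
      rw [transpose_mul, transpose_mul, hDt]
      simp only [Matrix.mul_assoc]
    rw [IsSymplectic, this, hOK, hD, twoForm, fromBlocks_multiply, fromBlocks_multiply, JJ]
    congr 1
    · simp [smul_smul, ← mul_assoc, sp']
    · simp
    · simp
    · simp [smul_smul, ← mul_assoc, sq']
  · have : D * O * L⁻¹ * (L * Lᵀ) * (D * O * L⁻¹)ᵀ =
        D * (O * ((L⁻¹ * L) * (Lᵀ * (L⁻¹)ᵀ)) * Oᵀ) * D := by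
      rw [transpose_mul, transpose_mul, hDt]
      simp only [Matrix.mul_assoc]
    rw [this, hLi, hLt, Matrix.one_mul, Matrix.mul_one, hO, Matrix.mul_one, hD,
      fromBlocks_multiply]
    simp [smul_smul, sp, sq]

end Williamson

/-! ### Symplectic eigenvalues and the partial transpose -/

section SymplecticSpectrum

theorem det_sq_of_symplectic {T : Matrix TwoModes TwoModes ℝ} (hT : IsSymplectic JJ T) :
    T.det ^ 2 = 1 := by
  have h : T * JJ * Tᵀ = JJ := hT
  have := congrArg det h
  rw [det_mul, det_mul, det_transpose, det_JJ] at this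
  linarith

theorem isUnit_of_symplectic {T : Matrix TwoModes TwoModes ℝ} (hT : IsSymplectic JJ T) :
    IsUnit T.det := by
  refine isUnit_iff_ne_zero.2 fun h => ?_
  have := det_sq_of_symplectic hT
  rw [h] at this
  norm_num at this

theorem posSemidef_herm_of_congr {T V w : Matrix TwoModes TwoModes ℝ} (hT : IsUnit T.det)
    (h : (herm (T * V * Tᵀ) (T * w * Tᵀ)).PosSemidef) : (herm V w).PosSemidef := by
  have e : ∀ M : Matrix TwoModes TwoModes ℝ, T⁻¹ * (T * M * Tᵀ) * (T⁻¹)ᵀ = M := by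
    intro M
    have h1 : T⁻¹ * T = 1 := nonsing_inv_mul _ hT
    have h2 : Tᵀ * (T⁻¹)ᵀ = 1 := by rw [← transpose_mul, h1, transpose_one]
    calc T⁻¹ * (T * M * Tᵀ) * (T⁻¹)ᵀ = (T⁻¹ * T) * M * (Tᵀ * (T⁻¹)ᵀ) := by
          simp only [Matrix.mul_assoc]
      _ = M := by rw [h1, h2, Matrix.one_mul, Matrix.mul_one]
  have := posSemidef_herm_congr h T⁻¹
  rwa [e, e] at this

theorem det_herm_smul_one (a t : ℝ) :
    (herm (a • (1 : Matrix (Fin 2) (Fin 2) ℝ)) (t • J)).det = ((a ^ 2 - t ^ 2 : ℝ) : ℂ) := by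
  rw [det_fin_two]
  simp only [herm_apply, J, Matrix.smul_apply, Matrix.one_apply]
  simp
  linear_combination ((t : ℂ) ^ 2) * Complex.I_sq

theorem det_herm_of_symplectic {T M : Matrix TwoModes TwoModes ℝ} {a b : ℝ}
    (hT : IsSymplectic JJ T) (hM : T * M * Tᵀ = fromBlocks (a • 1) 0 0 (b • 1)) (t : ℝ) :
    (herm M (t • JJ)).det = (((a ^ 2 - t ^ 2) * (b ^ 2 - t ^ 2) : ℝ) : ℂ) := by
  have hT' : T * JJ * Tᵀ = JJ := hT
  have h1 := congrArg det (herm_congr T M (t • JJ))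
  have h2 : (T.map Complex.ofReal).det = (T.det : ℂ) := (RingHom.map_det Complex.ofRealHom T).symm
  rw [hM, Matrix.mul_smul, Matrix.smul_mul, hT', JJ, fromBlocks_smul, smul_zero,
    herm_fromBlocks_diagonal, det_fromBlocks_zero₂₁, det_herm_smul_one, det_herm_smul_one,
    det_mul, det_mul, conjTranspose_map_ofReal, transpose_map, det_transpose, h2] at h1
  have h3 : (T.det : ℂ) ^ 2 = 1 := by exact_mod_cast det_sq_of_symplectic hT
  have h4 : (herm M (t • fromBlocks J 0 0 J)).det =
      (T.det : ℂ) * (herm M (t • fromBlocks J 0 0 J)).det * (T.det : ℂ) := by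
    linear_combination (-(herm M (t • fromBlocks J 0 0 J)).det) * h3
  rw [JJ, h4, fromBlocks_smul, smul_zero, h1]
  push_cast
  ring

theorem symplecticSpectrum_eq {T M : Matrix TwoModes TwoModes ℝ} {a b : ℝ}
    (hT : IsSymplectic JJ T) (hM : T * M * Tᵀ = fromBlocks (a • 1) 0 0 (b • 1))
    (ha : 0 < a) (hb : 0 < b) : symplecticSpectrum M = {a, b} := by
  have key : ∀ t : ℝ, Complex.I * (t : ℂ) ∈ spectrum ℂ ((JJ * M).map Complex.ofReal) ↔
      (a ^ 2 - t ^ 2) * (b ^ 2 - t ^ 2) = 0 := by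
    intro t
    -- Since `𝒥² = -1`, `𝒥 (M + i t 𝒥) = 𝒥 M - i t`; eigenvalues of `𝒥 M` are thus zeros of `det (M
    -- + i t 𝒥)`.
    have e : algebraMap ℂ (Matrix TwoModes TwoModes ℂ) (Complex.I * t) -
        (JJ * M).map Complex.ofReal = -(JJ.map Complex.ofReal * herm M (t • JJ)) := by
      have hs : (t • JJ).map Complex.ofReal = (t : ℂ) • JJ.map Complex.ofReal := by
        ext i j
        simp
      have h1 : JJ.map Complex.ofReal * herm M (t • JJ) =
          (JJ * M).map Complex.ofReal + Complex.I • ((t : ℂ) • (JJ * JJ).map Complex.ofReal) := by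
        rw [herm, Matrix.mul_add, map_ofReal_mul, map_ofReal_mul, hs, Matrix.mul_smul,
          Matrix.mul_smul]
      rw [h1, JJ_mul_JJ, Algebra.algebraMap_eq_smul_one]
      ext i j
      by_cases h : i = j <;> (simp [h]; try ring)
    have h2 : (JJ.map Complex.ofReal).det = 1 := by
      have : (JJ.map Complex.ofReal).det = (JJ.det : ℂ) :=
        (RingHom.map_det Complex.ofRealHom JJ).symm
      rw [this, det_JJ, Complex.ofReal_one]
    rw [spectrum.mem_iff, isUnit_iff_isUnit_det, e, det_neg, det_mul, h2,
      det_herm_of_symplectic hT hM, isUnit_iff_ne_zero, not_not, one_mul,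
      mul_eq_zero, Complex.ofReal_eq_zero]
    simp
  ext t
  simp only [symplecticSpectrum, Set.mem_ofPred_eq, key, Set.mem_insert_iff, Set.mem_singleton_iff]
  constructor
  · rintro ⟨h0, h⟩
    rcases mul_eq_zero.1 h with h | h
    · left; nlinarith
    · right; nlinarith
  · rintro (rfl | rfl)
    · exact ⟨ha.le, by ring⟩
    · exact ⟨hb.le, by ring⟩

theorem Lam_transpose : Lamᵀ = Lam := by
  have hZ : Zᵀ = Z := by
    ext i j
    fin_cases i <;> fin_cases j <;> simp [Z]
  simp [Lam, fromBlocks_transpose, hZ]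

theorem Z_mul_Z : Z * Z = 1 := by
  ext i j
  fin_cases i <;> fin_cases j <;> simp [Z]

theorem Lam_mul_Lam : Lam * Lam = 1 := by
  simp [Lam, fromBlocks_multiply, Z_mul_Z]

theorem Lam_twoForm (x y : ℝ) : Lam * twoForm x y * Lamᵀ = twoForm (-x) y := by
  rw [Lam_transpose, Lam, twoForm, twoForm, fromBlocks_multiply, fromBlocks_multiply]
  congr 1 <;> ext i j <;> fin_cases i <;> fin_cases j <;> simp [Z, J]

theorem isUnit_det_Lam : IsUnit Lam.det := by
  rw [← isUnit_iff_isUnit_det]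
  exact IsUnit.of_mul_eq_one _ Lam_mul_Lam

/-- Partial transposition reverses the sign of Alice's symplectic form. -/
theorem posSemidef_of_partialTranspose {V : Matrix TwoModes TwoModes ℝ} {x y : ℝ}
    (h : (herm (Lam * V * Lam) (twoForm x y)).PosSemidef) :
    (herm V (twoForm (-x) y)).PosSemidef := by
  refine posSemidef_herm_of_congr isUnit_det_Lam ?_
  rwa [Lam_twoForm, neg_neg, Lam_transpose]

theorem posDef_of_isCM {V : Matrix TwoModes TwoModes ℝ} (hV : IsCM JJ V) : V.PosDef := by
  have := posDef_herm_smul hV.2 (map_mulVec_injective JJ_mul_JJ) (t := 0) (by simp)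
  rw [zero_smul, herm_zero_right] at this
  exact posDef_of_map_ofReal this

theorem posDef_congr {T V : Matrix TwoModes TwoModes ℝ} (hV : V.PosDef) (hT : IsUnit T.det) :
    (T * V * Tᵀ).PosDef := by
  have := (IsUnit.posDef_star_right_conjugate_iff ((isUnit_iff_isUnit_det T).2 hT)).2 hV
  rwa [star_eq_conjTranspose, conjTranspose_eq_transpose_of_trivial] at this

theorem posDef_partialTranspose {V : Matrix TwoModes TwoModes ℝ} (hV : IsCM JJ V) :
    (Lam * V * Lam).PosDef := by
  have := posDef_congr (posDef_of_isCM hV) isUnit_det_Lam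
  rwa [Lam_transpose] at this

theorem one_le_det {V : Matrix TwoModes TwoModes ℝ} (hV : IsCM JJ V) : 1 ≤ V.det := by
  obtain ⟨T, a, b, hT, ha, hb, hD⟩ := exists_williamson (posDef_of_isCM hV)
  have hT' : T * JJ * Tᵀ = JJ := hT
  have h1 : (herm (T * V * Tᵀ) (T * JJ * Tᵀ)).PosSemidef := posSemidef_herm_congr hV.2 T
  rw [hD, hT', JJ, herm_fromBlocks_diagonal] at h1
  have aux : ∀ {a : ℝ}, 0 < a → (herm (a • (1 : Matrix (Fin 2) (Fin 2) ℝ)) J).PosSemidef → 1 ≤ a := by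
    intro a ha h
    have h2 := h.det_nonneg
    have h3 := det_herm_smul_one a 1
    rw [one_smul] at h3
    rw [h3] at h2
    have h4 : (0 : ℝ) ≤ a ^ 2 - 1 ^ 2 := by exact_mod_cast h2
    nlinarith
  have h1a := aux ha (h1.submatrix Sum.inl)
  have h1b := aux hb (h1.submatrix Sum.inr)
  have h5 := congrArg det hD
  rw [det_mul, det_mul, det_transpose, det_fromBlocks_zero₂₁, mul_right_comm, ← sq,
    det_sq_of_symplectic hT, one_mul, det_smul, det_smul] at h5
  simp only [Fintype.card_fin, det_one, mul_one] at h5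
  rw [h5]
  exact one_le_mul_of_one_le_of_one_le (one_le_pow₀ h1a) (one_le_pow₀ h1b)

theorem exists_diagonalizes {V : Matrix TwoModes TwoModes ℝ} (hV : IsCM JJ V) :
    ∃ T μ, Diagonalizes T μ V := by
  obtain ⟨T, a, b, hT, ha, hb, hD⟩ := exists_williamson (posDef_partialTranspose hV)
  have hnu : nu V = min a b := by
    rw [nu, symplecticSpectrum_eq hT hD ha hb, csInf_pair]
  rcases le_total a b with hab | hab
  · exact ⟨T, b, hT, by rw [hnu, min_eq_left hab, hD]⟩
  -- The swap of the two modes is symplectic and puts the smaller eigenvalue first.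
  · set P : Matrix TwoModes TwoModes ℝ := fromBlocks 0 1 1 0 with hP
    have hPt : Pᵀ = P := by simp [hP, fromBlocks_transpose]
    have hT' : T * JJ * Tᵀ = JJ := hT
    have e : ∀ M : Matrix TwoModes TwoModes ℝ, P * T * M * (P * T)ᵀ = P * (T * M * Tᵀ) * P := by
      intro M
      rw [transpose_mul, hPt]
      simp only [Matrix.mul_assoc]
    refine ⟨P * T, a, ?_, ?_⟩
    · rw [IsSymplectic, e, hT', hP, JJ]
      simp [fromBlocks_multiply]
    · rw [e, hD, hnu, min_eq_right hab, hP]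
      simp [fromBlocks_multiply]

/-- The last bound holds because partial transposition keeps the determinant: `(ν μ)² = det V ≥ 1`.
-/
theorem diagonalizes_bounds {T V : Matrix TwoModes TwoModes ℝ} {μ : ℝ} (hV : IsCM JJ V)
    (h : Diagonalizes T μ V) : 0 < nu V ∧ nu V ≤ μ ∧ 1 ≤ nu V * μ := by
  obtain ⟨hT, hD⟩ := h
  have hpd := posDef_congr (posDef_partialTranspose hV) (isUnit_of_symplectic hT)
  rw [hD] at hpd
  have h0 : 0 < nu V := by simpa using hpd.diag_pos (i := .inl 0)
  have h1 : 0 < μ := by simpa using hpd.diag_pos (i := .inr 0)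
  have h2 : nu V ≤ μ := by
    have : nu V = min (nu V) μ := by
      conv_lhs => rw [nu, symplecticSpectrum_eq hT hD h0 h1, csInf_pair]
    exact min_eq_left_iff.1 this.symm
  refine ⟨h0, h2, ?_⟩
  have h5 := congrArg det hD
  have hL : Lam.det * Lam.det = 1 := by rw [← det_mul, Lam_mul_Lam, det_one]
  rw [det_mul, det_mul, det_transpose, det_fromBlocks_zero₂₁, mul_right_comm, ← sq,
    det_sq_of_symplectic hT, one_mul, det_smul, det_smul, det_mul, det_mul, mul_right_comm, hL]
    at h5
  simp only [Fintype.card_fin, det_one, mul_one, one_mul] at h5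
  have h6 := one_le_det hV
  rw [h5, ← mul_pow] at h6
  exact (one_le_sq_iff₀ (mul_pos h0 h1).le).1 h6

theorem nu_lt_of_entangled {T V : Matrix TwoModes TwoModes ℝ} {μ : ℝ} (hV : IsCM JJ V)
    (hent : nu V < 1) (h : Diagonalizes T μ V) : nu V < μ := by
  obtain ⟨h0, h1, h2⟩ := diagonalizes_bounds hV h
  by_contra hle
  have : μ = nu V := le_antisymm (not_lt.1 hle) h1
  rw [this] at h2
  nlinarith

theorem posSemidef_herm_one_J : (herm (1 : Matrix (Fin 2) (Fin 2) ℝ) J).PosSemidef := by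
  have e : herm (1 : Matrix (Fin 2) (Fin 2) ℝ) J =
      vecMulVec ![1, -Complex.I] (star ![1, -Complex.I]) := by
    ext i j
    fin_cases i <;> fin_cases j <;> simp [herm_apply, J, vecMulVec_apply]
  rw [e]
  exact posSemidef_vecMulVec_self_star _

theorem posSemidef_herm_smul_one {a t : ℝ} (ht : 0 ≤ t) (h : t ≤ a) :
    (herm (a • (1 : Matrix (Fin 2) (Fin 2) ℝ)) (t • J)).PosSemidef := by
  have e : herm (a • (1 : Matrix (Fin 2) (Fin 2) ℝ)) (t • J) =
      ((a - t : ℝ) : ℂ) • (1 : Matrix (Fin 2) (Fin 2) ℂ) + (t : ℂ) • herm 1 J := by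
    ext i j
    by_cases hij : i = j <;> simp [herm_apply, hij] <;> ring
  rw [e]
  refine (PosSemidef.one.smul ?_).add (posSemidef_herm_one_J.smul ?_)
  · exact_mod_cast sub_nonneg.2 h
  · exact_mod_cast ht

theorem posSemidef_diagonalized {ν μ : ℝ} (h0 : 0 ≤ ν) (h : ν ≤ μ) :
    (herm (fromBlocks (ν • 1) 0 0 (μ • 1)) (ν • JJ)).PosSemidef := by
  rw [JJ, fromBlocks_smul, smul_zero, herm_fromBlocks_diagonal]
  exact posSemidef_fromBlocks_diagonal (posSemidef_herm_smul_one h0 le_rfl)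
    (posSemidef_herm_smul_one h0 h)

/-- The lowest symplectic eigenvalue bounds the partial transpose: `V + i ν (-J ⊕ J) ≥ 0`. -/
theorem posSemidef_nu {V : Matrix TwoModes TwoModes ℝ} (hV : IsCM JJ V) :
    (herm V (twoForm (-nu V) (nu V))).PosSemidef := by
  obtain ⟨T, μ, hd⟩ := exists_diagonalizes hV
  obtain ⟨h0, h1, -⟩ := diagonalizes_bounds hV hd
  obtain ⟨hT, hD⟩ := hd
  have hT' : T * JJ * Tᵀ = JJ := hT
  refine posSemidef_of_partialTranspose (posSemidef_herm_of_congr (isUnit_of_symplectic hT) ?_)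
  have e : twoForm (nu V) (nu V) = nu V • JJ := by simp [twoForm, JJ, fromBlocks_smul]
  rw [hD, e, Matrix.mul_smul, Matrix.smul_mul, hT']
  exact posSemidef_diagonalized h0.le h1

end SymplecticSpectrum

/-! ### First-order perturbation and the asymmetric case -/

section Perturbation

/-- A Hermitian perturbation that is positive on the kernel of a positive semidefinite matrix
preserves positivity to first order. -/
theorem exists_posSemidef_perturbation {ι : Type} [Fintype ι] {H P : Matrix ι ι ℂ}
    (hH : H.PosSemidef) (hP : P.IsHermitian)
    (hpos : ∀ u, u ≠ 0 → H *ᵥ u = 0 → 0 < (star u ⬝ᵥ (P *ᵥ u)).re) :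
    ∃ ε₀ : ℝ, 0 < ε₀ ∧ ∀ ε : ℝ, 0 ≤ ε → ε ≤ ε₀ → (H + (ε : ℂ) • P).PosSemidef := by
  set f : (ι → ℂ) → ℝ := fun u => (star u ⬝ᵥ (H *ᵥ u)).re with hf
  set g : (ι → ℂ) → ℝ := fun u => (star u ⬝ᵥ (P *ᵥ u)).re with hg
  have hfc : Continuous f := by
    simp only [hf, dotProduct, mulVec, Pi.star_apply]
    fun_prop
  have hgc : Continuous g := by
    simp only [hg, dotProduct, mulVec, Pi.star_apply]
    fun_prop
  have hf0 : ∀ u, 0 ≤ f u := (posSemidef_iff_re hH.1).1 hH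
  have hfpos : ∀ u, u ≠ 0 → g u ≤ 0 → 0 < f u := by
    intro u hu hgu
    refine lt_of_le_of_ne (hf0 u) fun h => ?_
    have h1 : star u ⬝ᵥ (H *ᵥ u) = 0 := by
      have h2 := Complex.nonneg_iff.1 (hH.dotProduct_mulVec_nonneg u)
      exact Complex.ext h.symm h2.2.symm
    exact absurd (hpos u hu ((hH.dotProduct_mulVec_zero_iff u).1 h1)) (not_lt.2 hgu)
  have hsphere : ∃ ε₀ : ℝ, 0 < ε₀ ∧ ∀ ε : ℝ, 0 ≤ ε → ε ≤ ε₀ →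
      ∀ u ∈ Metric.sphere (0 : ι → ℂ) 1, 0 ≤ f u + ε * g u := by
    have hK : IsCompact (Metric.sphere (0 : ι → ℂ) 1 ∩ {u | g u ≤ 0}) :=
      (isCompact_sphere _ _).inter_right (isClosed_le hgc continuous_const)
    rcases (Metric.sphere (0 : ι → ℂ) 1 ∩ {u | g u ≤ 0}).eq_empty_or_nonempty with he | hne
    · refine ⟨1, one_pos, fun ε h0 _ u hu => ?_⟩
      have : 0 < g u := by
        by_contra h
        have : u ∈ Metric.sphere (0 : ι → ℂ) 1 ∩ {u | g u ≤ 0} := ⟨hu, not_lt.1 h⟩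
        rw [he] at this
        exact this
      have := hf0 u
      positivity
    · obtain ⟨u₀, hu₀, hmin₀⟩ := hK.exists_isMinOn hne hfc.continuousOn
      obtain ⟨u₁, hu₁, hmin₁⟩ := hK.exists_isMinOn hne hgc.continuousOn
      have hm : 0 < f u₀ := by
        refine hfpos u₀ ?_ hu₀.2
        rintro rfl
        simpa using hu₀.1
      have hC : 0 ≤ -g u₁ := neg_nonneg.2 hu₁.2
      -- Only the part of the sphere with `g ≤ 0` constrains `ε`. There `f ≥ f u₀ > 0` and `g ≥ g
      -- u₁`, so `ε (-g u₁) ≤ f u₀` suffices; the `+ 1` keeps the denominator positive.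
      refine ⟨f u₀ / (-g u₁ + 1), by positivity, fun ε h0 hε u hu => ?_⟩
      by_cases hgu : g u ≤ 0
      · have h1 : f u₀ ≤ f u := hmin₀ ⟨hu, hgu⟩
        have h2 : g u₁ ≤ g u := hmin₁ ⟨hu, hgu⟩
        have h3 := (le_div_iff₀ (by linarith : 0 < -g u₁ + 1)).1 hε
        nlinarith
      · have := hf0 u
        have : 0 < g u := not_le.1 hgu
        positivity
  obtain ⟨ε₀, hε₀, h⟩ := hsphere
  refine ⟨ε₀, hε₀, fun ε h0 hε => ?_⟩
  have hherm : (H + (ε : ℂ) • P).IsHermitian := by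
    rw [IsHermitian, conjTranspose_add, conjTranspose_smul, hH.1, hP]
    simp
  refine (posSemidef_iff_re hherm).2 fun u => ?_
  by_cases hu : u = 0
  · simp [hu]
  · have hn : (‖u‖ : ℂ) ≠ 0 := by exact_mod_cast norm_ne_zero_iff.2 hu
    set v : ι → ℂ := (‖u‖ : ℂ)⁻¹ • u with hv
    have huv : u = (‖u‖ : ℂ) • v := by rw [hv, smul_smul, mul_inv_cancel₀ hn, one_smul]
    have hvs : v ∈ Metric.sphere (0 : ι → ℂ) 1 := by
      rw [mem_sphere_zero_iff_norm, hv, norm_smul, norm_inv, Complex.norm_real, norm_norm,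
        inv_mul_cancel₀ (norm_ne_zero_iff.2 hu)]
    have e : (star u ⬝ᵥ ((H + (ε : ℂ) • P) *ᵥ u)) =
        ((‖u‖ ^ 2 : ℝ) : ℂ) * (star v ⬝ᵥ (H *ᵥ v) + ε * (star v ⬝ᵥ (P *ᵥ v))) := by
      have e1 : star v ⬝ᵥ (H *ᵥ v) + ε * (star v ⬝ᵥ (P *ᵥ v)) =
          star v ⬝ᵥ ((H + (ε : ℂ) • P) *ᵥ v) := by
        rw [add_mulVec, dotProduct_add, smul_mulVec, dotProduct_smul, smul_eq_mul]
      rw [e1]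
      nth_rw 1 2 [huv]
      rw [mulVec_smul, star_smul, smul_dotProduct, dotProduct_smul]
      simp only [smul_eq_mul, Complex.star_def, Complex.conj_ofReal]
      push_cast
      ring
    rw [e, Complex.re_ofReal_mul, Complex.add_re, Complex.re_ofReal_mul]
    exact mul_nonneg (sq_nonneg _) (h ε h0 hε v hvs)

theorem mul_J_mul_transpose (W : Matrix (Fin 2) (Fin 2) ℝ) : W * J * Wᵀ = W.det • J := by
  ext i j
  fin_cases i <;> fin_cases j <;>
    simp [J, Matrix.mul_apply, det_fin_two, Fin.sum_univ_two] <;> ring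

theorem isSymplectic_J_iff {W : Matrix (Fin 2) (Fin 2) ℝ} : IsSymplectic J W ↔ W.det = 1 := by
  rw [IsSymplectic, mul_J_mul_transpose]
  constructor
  · intro h
    simpa [J] using congrFun (congrFun h 0) 1
  · intro h
    rw [h, one_smul]

theorem symplectic_rows {T : Matrix TwoModes TwoModes ℝ} (hT : IsSymplectic JJ T) :
    T.toBlocks₁₁.det + T.toBlocks₁₂.det = 1 ∧ T.toBlocks₂₁.det + T.toBlocks₂₂.det = 1 ∧
      T.toBlocks₁₁ * J * T.toBlocks₂₁ᵀ = -(T.toBlocks₁₂ * J * T.toBlocks₂₂ᵀ) := by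
  have h : T * JJ * Tᵀ = JJ := hT
  rw [← fromBlocks_toBlocks T, JJ, fromBlocks_transpose, fromBlocks_multiply, fromBlocks_multiply,
    fromBlocks_inj] at h
  simp only [Matrix.mul_zero, zero_add, add_zero, mul_J_mul_transpose] at h
  obtain ⟨h1, h2, -, h4⟩ := h
  refine ⟨?_, ?_, eq_neg_of_add_eq_zero_left h2⟩
  · simpa [J] using congrFun (congrFun h1 0) 1
  · simpa [J] using congrFun (congrFun h4 0) 1

theorem isSymplectic_transpose {T : Matrix TwoModes TwoModes ℝ} (hT : IsSymplectic JJ T) :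
    IsSymplectic JJ Tᵀ := by
  have h : T * JJ * Tᵀ = JJ := hT
  have h1 : T * (JJ * Tᵀ * (-JJ)) = 1 := by
    rw [← Matrix.mul_assoc, ← Matrix.mul_assoc, h, Matrix.mul_neg, JJ_mul_JJ, neg_neg]
  have h2 := mul_eq_one_comm.1 h1
  rw [IsSymplectic, transpose_transpose]
  have h3 : JJ * (JJ * Tᵀ * (-JJ) * T) = JJ := by rw [h2, Matrix.mul_one]
  calc Tᵀ * JJ * T = (-(JJ * JJ)) * Tᵀ * JJ * T := by rw [JJ_mul_JJ, neg_neg, Matrix.one_mul]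
    _ = JJ * (JJ * Tᵀ * (-JJ) * T) := by
      simp only [Matrix.neg_mul, Matrix.mul_neg, Matrix.mul_assoc]
    _ = JJ := h3

/-- The kernel of `diag(ν, ν, μ, μ) + i ν 𝒥` is a line. -/
theorem kernel_diagonalized {ν μ : ℝ} (h0 : 0 < ν) (h : ν < μ) {u : TwoModes → ℂ}
    (hu : herm (fromBlocks (ν • 1) 0 0 (μ • 1)) (ν • JJ) *ᵥ u = 0) :
    u (.inl 0) = -Complex.I * u (.inl 1) ∧ u (.inr 0) = 0 ∧ u (.inr 1) = 0 := by
  have k0 := congrFun hu (.inl 0)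
  have k2 := congrFun hu (.inr 0)
  have k3 := congrFun hu (.inr 1)
  simp [mulVec, dotProduct, herm_apply, JJ, J] at k0 k2 k3
  have hν : (ν : ℂ) ≠ 0 := by exact_mod_cast h0.ne'
  have hμ : (μ : ℂ) ≠ 0 := by exact_mod_cast (h0.trans h).ne'
  have hd : ((μ : ℂ) ^ 2 - (ν : ℂ) ^ 2) ≠ 0 := by
    have : μ ^ 2 - ν ^ 2 ≠ 0 := by nlinarith
    exact_mod_cast this
  have e0 : (ν : ℂ) * (u (.inl 0) + Complex.I * u (.inl 1)) = 0 := by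
    linear_combination k0
  have e3 : ((μ : ℂ) ^ 2 - (ν : ℂ) ^ 2) * u (.inr 1) = 0 := by
    linear_combination (μ : ℂ) * k3 + Complex.I * ν * k2 - (ν : ℂ) ^ 2 * u (.inr 1) * Complex.I_sq
  have f3 := (mul_eq_zero.1 e3).resolve_left hd
  rw [f3] at k2
  refine ⟨?_, ?_, f3⟩
  · linear_combination (mul_eq_zero.1 e0).resolve_left hν
  · simpa [hμ] using k2

theorem twoForm_transpose (x y : ℝ) : (twoForm x y)ᵀ = -twoForm x y := by
  simp [twoForm, fromBlocks_transpose, J_transpose, fromBlocks_neg]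

/-- An asymmetric diagonalization leaves room for a stronger uncertainty relation. -/
theorem exists_stronger_of_det_ne {T V : Matrix TwoModes TwoModes ℝ} {μ : ℝ} (hV : IsCM JJ V)
    (hent : nu V < 1) (hd : Diagonalizes T μ V) (hne : T.toBlocks₁₁.det ≠ T.toBlocks₁₂.det) :
    ∃ x y : ℝ, |x| ≤ 1 ∧ |y| ≤ 1 ∧ 2 * nu V < y - x ∧ (herm V (twoForm x y)).PosSemidef := by
  obtain ⟨h0, h1, -⟩ := diagonalizes_bounds hV hd
  have hlt := nu_lt_of_entangled hV hent hd
  obtain ⟨hT, hD⟩ := hd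
  have hT' : T * JJ * Tᵀ = JJ := hT
  obtain ⟨hsum, -, -⟩ := symplectic_rows hT
  set ν := nu V
  set s := T.toBlocks₁₁.det - T.toBlocks₁₂.det with hs
  have hs0 : 0 < s ^ 2 := by
    have : s ≠ 0 := sub_ne_zero.2 hne
    positivity
  -- As `det Wa = (1 + s) / 2` and `det Wb = (1 - s) / 2`, this choice makes `da det Wa + db det Wb
  -- = -s² / 2` while `da + db = s² > 0`. On the kernel line `i J` is negative, so a negative
  -- multiple of `J` gives a positive perturbation there.
  set da := -s + s ^ 2 / 2 with hda
  set db := s + s ^ 2 / 2 with hdb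
  set p := T * twoForm da db * Tᵀ with hp
  have hpt : pᵀ = -p := by
    rw [hp, transpose_mul, transpose_mul, transpose_transpose, twoForm_transpose]
    simp [Matrix.mul_assoc]
  have hp11 : p.toBlocks₁₁ = (-(s ^ 2 / 2)) • J := by
    have e : p.toBlocks₁₁ = da • (T.toBlocks₁₁ * J * T.toBlocks₁₁ᵀ) +
        db • (T.toBlocks₁₂ * J * T.toBlocks₁₂ᵀ) := by
      rw [hp, twoForm]
      nth_rw 1 2 [← fromBlocks_toBlocks T]
      rw [fromBlocks_transpose, fromBlocks_multiply, fromBlocks_multiply]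
      simp
    rw [e, mul_J_mul_transpose, mul_J_mul_transpose, smul_smul, smul_smul, ← add_smul]
    congr 1
    have ea : T.toBlocks₁₁.det = (1 + s) / 2 := by linarith
    have eb : T.toBlocks₁₂.det = (1 - s) / 2 := by linarith
    rw [ea, eb, hda, hdb]
    ring
  have hP : (herm 0 p).IsHermitian := by
    ext i j
    have := congrFun (congrFun hpt i) j
    simp only [transpose_apply, Matrix.neg_apply] at this
    simp [herm_apply, conjTranspose_apply, this]
  obtain ⟨ε₀, hε₀, hε⟩ := exists_posSemidef_perturbation (posSemidef_diagonalized h0.le h1) hP (by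
    intro u hu hku
    obtain ⟨k0, k2, k3⟩ := kernel_diagonalized h0 hlt hku
    have hu1 : u (.inl 1) ≠ 0 := by
      intro h
      refine hu ?_
      ext (i | i) <;> fin_cases i <;> simp [k0, k2, k3, h]
    have b : ∀ i j, p (.inl i) (.inl j) = -(s ^ 2 / 2) * J i j := fun i j =>
      congrFun (congrFun hp11 i) j
    have e : star u ⬝ᵥ (herm 0 p *ᵥ u) = ((s ^ 2 * Complex.normSq (u (.inl 1)) : ℝ) : ℂ) := by
      simp [mulVec, dotProduct, herm_apply, k0, k2, k3, b, J]
      rw [Complex.normSq_eq_conj_mul_self]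
      ring_nf
      simp only [Complex.I_sq]
      ring
    rw [e, Complex.ofReal_re]
    exact mul_pos hs0 (Complex.normSq_pos.2 hu1))
  set c := |s| + s ^ 2 / 2 with hc
  have hc0 : 0 ≤ c := by positivity
  -- The second cap uses the room `1 - ν > 0` to keep both perturbed coefficients in `[-1, 1]`.
  set ε := min ε₀ ((1 - ν) / (c + 1)) with hεdef
  have hεpos : 0 < ε := lt_min hε₀ (div_pos (by linarith) (by linarith))
  have hεc : ε * c ≤ 1 - ν := by
    have h2 : ε ≤ (1 - ν) / (c + 1) := min_le_right _ _
    rw [le_div_iff₀ (by linarith)] at h2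
    linarith
  have ha := abs_le.1 (le_refl |s|)
  have bda : |da| ≤ c := abs_le.2 ⟨by rw [hda, hc]; linarith, by rw [hda, hc]; linarith⟩
  have bdb : |db| ≤ c := abs_le.2 ⟨by rw [hdb, hc]; linarith, by rw [hdb, hc]; linarith⟩
  have bound : ∀ d, |d| ≤ c → |ν + ε * d| ≤ 1 := by
    intro d hd
    obtain ⟨d1, d2⟩ := abs_le.1 hd
    have e1 : ε * d ≤ ε * c := mul_le_mul_of_nonneg_left d2 hεpos.le
    have e2 : ε * (-c) ≤ ε * d := mul_le_mul_of_nonneg_left d1 hεpos.le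
    exact abs_le.2 ⟨by linarith, by linarith⟩
  have hpsd := hε ε hεpos.le (min_le_left _ _)
  have eq1 : herm (fromBlocks (ν • 1) 0 0 (μ • 1)) (ν • JJ) + (ε : ℂ) • herm 0 p =
      herm (T * (Lam * V * Lam) * Tᵀ) (T * twoForm (ν + ε * da) (ν + ε * db) * Tᵀ) := by
    have e2 : twoForm (ν + ε * da) (ν + ε * db) = ν • JJ + ε • twoForm da db := by
      simp [twoForm, JJ, fromBlocks_smul, fromBlocks_add, add_smul, smul_smul]
    rw [smul_herm, herm_add, hD, e2, Matrix.mul_add, Matrix.add_mul, Matrix.mul_smul,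
      Matrix.smul_mul, hT', Matrix.mul_smul, Matrix.smul_mul]
    simp [hp]
  rw [eq1] at hpsd
  refine ⟨-(ν + ε * da), ν + ε * db, ?_, bound db bdb, ?_,
    posSemidef_of_partialTranspose (posSemidef_herm_of_congr (isUnit_of_symplectic hT) hpsd)⟩
  · rw [abs_neg]
    exact bound da bda
  · have : ε * da + ε * db = ε * s ^ 2 := by rw [hda, hdb]; ring
    have : 0 < ε * s ^ 2 := mul_pos hεpos hs0
    linarith

/-- The cross term depends only on `W J Xᵀ`. By `symplectic_rows` these matrices for Alice and Bob
are opposite, so the cross terms cancel in `det A - det B`. -/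
theorem det_gram_add (ν μ : ℝ) (W X : Matrix (Fin 2) (Fin 2) ℝ) :
    (ν • (Wᵀ * W) + μ • (Xᵀ * X)).det = ν ^ 2 * W.det ^ 2 + μ ^ 2 * X.det ^ 2 +
      ν * μ * ∑ i, ∑ j, (W * J * Xᵀ) i j ^ 2 := by
  simp [det_fin_two, Matrix.mul_apply, Fin.sum_univ_two, J]
  ring

/-- The local invariants of `V` in terms of a diagonalization of its partial transpose. -/
theorem local_det_sub {T V : Matrix TwoModes TwoModes ℝ} {μ : ℝ} (hd : Diagonalizes T μ V) :
    V.toBlocks₁₁.det - V.toBlocks₂₂.det =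
      (nu V ^ 2 - μ ^ 2) * (T.toBlocks₁₁.det - T.toBlocks₁₂.det) := by
  obtain ⟨hT, hD⟩ := hd
  have hTt : Tᵀ * JJ * T = JJ := by
    have : Tᵀ * JJ * Tᵀᵀ = JJ := isSymplectic_transpose hT
    rwa [transpose_transpose] at this
  obtain ⟨r1, r2, r3⟩ := symplectic_rows hT
  obtain ⟨c1, c2, -⟩ := symplectic_rows (isSymplectic_transpose hT)
  have ct : Tᵀ.toBlocks₁₁ = T.toBlocks₁₁ᵀ ∧ Tᵀ.toBlocks₁₂ = T.toBlocks₂₁ᵀ ∧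
      Tᵀ.toBlocks₂₁ = T.toBlocks₁₂ᵀ ∧ Tᵀ.toBlocks₂₂ = T.toBlocks₂₂ᵀ := ⟨rfl, rfl, rfl, rfl⟩
  rw [ct.1, ct.2.1, det_transpose, det_transpose] at c1
  rw [ct.2.2.1, ct.2.2.2, det_transpose, det_transpose] at c2
  set D : Matrix TwoModes TwoModes ℝ := fromBlocks (nu V • 1) 0 0 (μ • 1) with hDdef
  have hDJ : JJ * D * JJ = -D := by
    simp [hDdef, JJ, fromBlocks_multiply, fromBlocks_neg, J_mul_J]
  -- Here `T⁻¹ = -𝒥 Tᵀ 𝒥`, and `𝒥 D 𝒥 = -D` because `D` is scalar on each mode.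
  have hVt : Lam * V * Lam = JJ * (Tᵀ * D * T) * JJᵀ := by
    have e1 : (-JJ) * Tᵀ * JJ * T = 1 := by
      rw [Matrix.mul_assoc, Matrix.mul_assoc, ← Matrix.mul_assoc Tᵀ, hTt, Matrix.neg_mul,
        JJ_mul_JJ, neg_neg]
    have e2 : Tᵀ * ((-JJ) * T * JJ) = 1 := by
      have := congrArg transpose e1
      simp only [transpose_mul, transpose_neg, JJ_transpose, transpose_transpose, neg_neg,
        transpose_one] at this
      simpa [Matrix.mul_assoc] using this
    calc Lam * V * Lam = ((-JJ) * Tᵀ * JJ * T) * (Lam * V * Lam) * (Tᵀ * ((-JJ) * T * JJ)) := by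
          rw [e1, e2, Matrix.one_mul, Matrix.mul_one]
      _ = (-JJ) * Tᵀ * JJ * (T * (Lam * V * Lam) * Tᵀ) * (-JJ) * T * JJ := by
          simp only [Matrix.mul_assoc]
      _ = (-JJ) * Tᵀ * (-(JJ * D * JJ)) * T * JJ := by
          rw [hD]
          simp only [Matrix.mul_assoc, Matrix.neg_mul, Matrix.mul_neg]
      _ = JJ * (Tᵀ * D * T) * JJᵀ := by
          rw [hDJ, JJ_transpose]
          simp only [Matrix.mul_assoc, Matrix.neg_mul, Matrix.mul_neg, neg_neg]
  have b1 : Z * V.toBlocks₁₁ * Z = J * (nu V • (T.toBlocks₁₁ᵀ * T.toBlocks₁₁) +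
      μ • (T.toBlocks₂₁ᵀ * T.toBlocks₂₁)) * Jᵀ ∧
      V.toBlocks₂₂ = J * (nu V • (T.toBlocks₁₂ᵀ * T.toBlocks₁₂) +
      μ • (T.toBlocks₂₂ᵀ * T.toBlocks₂₂)) * Jᵀ := by
    rw [← fromBlocks_toBlocks V, ← fromBlocks_toBlocks T, hDdef, Lam, JJ, fromBlocks_transpose,
      fromBlocks_transpose, fromBlocks_multiply, fromBlocks_multiply, fromBlocks_multiply,
      fromBlocks_multiply, fromBlocks_multiply, fromBlocks_multiply, fromBlocks_inj] at hVt
    obtain ⟨v1, -, -, v4⟩ := hVt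
    simp at v1 v4
    exact ⟨v1, v4⟩
  have dZ : Z.det * Z.det = 1 := by rw [← det_mul, Z_mul_Z, det_one]
  have d1 := congrArg det b1.1
  have d2 := congrArg det b1.2
  rw [det_mul, det_mul, mul_right_comm, dZ, one_mul, det_mul, det_mul, det_transpose, det_J,
    one_mul, mul_one, det_gram_add] at d1
  rw [det_mul, det_mul, det_transpose, det_J, one_mul, mul_one, det_gram_add] at d2
  have hs : ∑ i, ∑ j, (T.toBlocks₁₁ * J * T.toBlocks₂₁ᵀ) i j ^ 2 =
      ∑ i, ∑ j, (T.toBlocks₁₂ * J * T.toBlocks₂₂ᵀ) i j ^ 2 := by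
    rw [r3]
    simp
  rw [hs] at d1
  -- The row relations of `T` and of `Tᵀ` together identify opposite block determinants.
  have x1 : T.toBlocks₂₁.det = T.toBlocks₁₂.det := by linarith
  have x2 : T.toBlocks₂₂.det = T.toBlocks₁₁.det := by linarith
  rw [x1] at d1
  rw [x2] at d2
  rw [d1, d2]
  linear_combination (nu V ^ 2 - μ ^ 2) * (T.toBlocks₁₁.det - T.toBlocks₁₂.det) * r1

theorem isSymmetricState_iff {T V : Matrix TwoModes TwoModes ℝ} {μ : ℝ} (hV : IsCM JJ V)
    (hent : nu V < 1) (hd : Diagonalizes T μ V) :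
    IsSymmetricState V ↔ T.toBlocks₁₁.det = T.toBlocks₁₂.det := by
  obtain ⟨h0, -, -⟩ := diagonalizes_bounds hV hd
  have hlt := nu_lt_of_entangled hV hent hd
  have h := local_det_sub hd
  have hne : nu V ^ 2 - μ ^ 2 ≠ 0 := by nlinarith
  rw [IsSymmetricState, ← sub_eq_zero, h, mul_eq_zero, or_iff_right hne, sub_eq_zero]

end Perturbation

/-! ### The optimal fidelity and the maps that attain it -/

section Optimality

variable {V : Matrix TwoModes TwoModes ℝ}

theorem fidelity_applyLocal_le (hV : IsCM JJ V) {x y : ℝ} (hx : |x| ≤ 1) (hy : |y| ≤ 1)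
    (hxy : 0 ≤ y - x) (h : (herm V (twoForm x y)).PosSemidef) (Ea Eb : GCP) :
    fidelity (applyLocal Ea Eb V) ≤ 2 / (2 + (y - x)) :=
  (fidelity_bound hxy (posSemidef_applyLocal Ea Eb V hx hy hV.1 h)).1

/-- The Gaussian operation of a local symplectic map. -/
def gcpOfSymplectic (S : Matrix (Fin 2) (Fin 2) ℝ) (hS : IsSymplectic J S) : GCP where
  d := 0
  m := 0
  σ := 0
  σ_cm := ⟨by simp [IsSymm], by
    convert! PosSemidef.zero (n := Modes 0 ⊕ Modes 0) (R := ℂ)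
    ext i
    exact isEmptyElim i⟩
  S := fromBlocks S 0 0 1
  S_symplectic := by
    have h : S * J * Sᵀ = J := hS
    rw [IsSymplectic, dilForm, fromBlocks_transpose, fromBlocks_multiply, fromBlocks_multiply]
    simp [h]
  τ := 0
  τ_cm := ⟨by simp [IsSymm], by
    convert! PosSemidef.zero (n := Modes 0) (R := ℂ)
    ext i
    exact isEmptyElim i⟩

theorem applyLocal_gcpOfSymplectic {Sa Sb : Matrix (Fin 2) (Fin 2) ℝ} (ha : IsSymplectic J Sa)
    (hb : IsSymplectic J Sb) :
    applyLocal (gcpOfSymplectic Sa ha) (gcpOfSymplectic Sb hb) V = localAct Sa Sb 0 0 V :=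
  applyLocal_of_decoupled _ _ (toBlocks_fromBlocks₁₂ _ _ _ _) (toBlocks_fromBlocks₁₂ _ _ _ _) V

theorem det_sqrt_two_smul {W : Matrix (Fin 2) (Fin 2) ℝ} (h : W.det = 1 / 2) :
    (√2 • W).det = 1 := by
  rw [det_smul, Fintype.card_fin, Real.sq_sqrt (by norm_num), h]
  norm_num

theorem det_Z_mul_mul_Z (W : Matrix (Fin 2) (Fin 2) ℝ) : (Z * W * Z).det = W.det := by
  have : Z.det * Z.det = 1 := by rw [← det_mul, Z_mul_Z, det_one]
  rw [det_mul, det_mul, mul_right_comm, this, one_mul]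

/-- The rows `(Z I)` times the local map are `√2 (Wa Wb) Λ`, so the noise is twice the upper block
`ν I` of the diagonalized partial transpose. Symmetry plays no role here; it is needed to make the
map symplectic. -/
theorem fidelity_localAct (hV : IsCM JJ V) {T : Matrix TwoModes TwoModes ℝ} {μ : ℝ}
    (hd : Diagonalizes T μ V) :
    fidelity (localAct (√2 • (Z * T.toBlocks₁₁ * Z)) (√2 • T.toBlocks₁₂) 0 0 V) =
      1 / (1 + nu V) := by
  obtain ⟨h0, -, -⟩ := diagonalizes_bounds hV hd
  have hN : noise (localAct (√2 • (Z * T.toBlocks₁₁ * Z)) (√2 • T.toBlocks₁₂) 0 0 V) =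
      (2 * nu V) • 1 := by
    have hs : √2 * √2 = (2 : ℝ) := Real.mul_self_sqrt (by norm_num)
    have e1 : noiseRow * fromBlocks (√2 • (Z * T.toBlocks₁₁ * Z)) 0 0 (√2 • T.toBlocks₁₂) =
        √2 • (fromCols T.toBlocks₁₁ T.toBlocks₁₂ * Lam) := by
      rw [noiseRow, Lam, fromCols_mul_fromBlocks, fromCols_mul_fromBlocks]
      simp only [← Matrix.mul_assoc, Z_mul_Z, Matrix.one_mul, Matrix.mul_zero,
        Matrix.mul_one, add_zero, zero_add, Matrix.mul_smul]
      ext i (j | j) <;> simp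
    have e2 : fromCols T.toBlocks₁₁ T.toBlocks₁₂ * (Lam * V * Lam) *
        (fromCols T.toBlocks₁₁ T.toBlocks₁₂)ᵀ = nu V • 1 := by
      have h1 : fromCols T.toBlocks₁₁ T.toBlocks₁₂ = T.submatrix Sum.inl id := by
        ext i (j | j) <;> rfl
      have h2 := congrArg toBlocks₁₁ hd.2
      rw [toBlocks_fromBlocks₁₁] at h2
      rw [h1, ← h2]
      rfl
    have e3 : noise (localAct (√2 • (Z * T.toBlocks₁₁ * Z)) (√2 • T.toBlocks₁₂) 0 0 V) =
        (noiseRow * fromBlocks (√2 • (Z * T.toBlocks₁₁ * Z)) 0 0 (√2 • T.toBlocks₁₂)) * V *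
        (noiseRow * fromBlocks (√2 • (Z * T.toBlocks₁₁ * Z)) 0 0 (√2 • T.toBlocks₁₂))ᵀ := by
      rw [noise_eq, localAct, fromBlocks_zero, add_zero, transpose_mul]
      simp only [Matrix.mul_assoc]
    have e4 : fromCols T.toBlocks₁₁ T.toBlocks₁₂ * Lam * V *
        (fromCols T.toBlocks₁₁ T.toBlocks₁₂ * Lam)ᵀ = nu V • 1 := by
      rw [← e2, transpose_mul, Lam_transpose]
      simp only [Matrix.mul_assoc]
    rw [e3, e1, transpose_smul, Matrix.smul_mul, Matrix.smul_mul, Matrix.mul_smul, e4, smul_smul,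
      smul_smul, hs]
  have hdet : ((2 : ℝ) • (1 : Matrix (Fin 2) (Fin 2) ℝ) + (2 * nu V) • 1).det =
      (2 + 2 * nu V) ^ 2 := by
    rw [← add_smul, det_smul]
    simp
  rw [fidelity, hN, hdet, Real.sqrt_sq (by linarith)]
  rw [div_eq_div_iff (by linarith) (by linarith)]
  ring

theorem fidelity_le_of_entangled (hV : IsCM JJ V) (hent : nu V < 1) (Ea Eb : GCP) :
    fidelity (applyLocal Ea Eb V) ≤ 1 / (1 + nu V) := by
  obtain ⟨T, μ, hd⟩ := exists_diagonalizes hV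
  obtain ⟨h0, -, -⟩ := diagonalizes_bounds hV hd
  have h := fidelity_applyLocal_le hV (x := -nu V) (y := nu V)
    (by rw [abs_neg, abs_of_pos h0]; exact hent.le) (by rw [abs_of_pos h0]; exact hent.le)
    (by linarith) (posSemidef_nu hV) Ea Eb
  have e : 2 / (2 + (nu V - -nu V)) = 1 / (1 + nu V) := by
    rw [div_eq_div_iff (by linarith) (by linarith)]
    ring
  rwa [e] at h

/-- The local operation that does nothing. -/
def gcpId : GCP := gcpOfSymplectic 1 (by simp [IsSymplectic])

theorem Fopt_le_of_forall {r : ℝ} (h : ∀ Ea Eb : GCP, fidelity (applyLocal Ea Eb V) ≤ r) :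
    Fopt V ≤ r := by
  refine csSup_le ⟨_, (gcpId, gcpId), rfl⟩ ?_
  rintro _ ⟨E, rfl⟩
  exact h E.1 E.2

theorem Fopt_le (hV : IsCM JJ V) (hent : nu V < 1) : Fopt V ≤ 1 / (1 + nu V) :=
  Fopt_le_of_forall (fidelity_le_of_entangled hV hent)

theorem fidelity_le_Fopt (hV : IsCM JJ V) (hent : nu V < 1) (Ea Eb : GCP) :
    fidelity (applyLocal Ea Eb V) ≤ Fopt V := by
  refine le_csSup ⟨1 / (1 + nu V), ?_⟩ ⟨(Ea, Eb), rfl⟩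
  rintro _ ⟨E, rfl⟩
  exact fidelity_le_of_entangled hV hent E.1 E.2

/-- For an asymmetric entangled state the bound `1 / (1 + ν)` is not approached. -/
theorem Fopt_lt_of_not_symmetric (hV : IsCM JJ V) (hent : nu V < 1) (hs : ¬IsSymmetricState V) :
    Fopt V < 1 / (1 + nu V) := by
  obtain ⟨T, μ, hd⟩ := exists_diagonalizes hV
  obtain ⟨h0, -, -⟩ := diagonalizes_bounds hV hd
  obtain ⟨x, y, hx, hy, hxy, h⟩ := exists_stronger_of_det_ne hV hent hd
    fun e => hs ((isSymmetricState_iff hV hent hd).2 e)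
  refine (Fopt_le_of_forall (fidelity_applyLocal_le hV hx hy (by linarith) h)).trans_lt ?_
  rw [div_lt_div_iff₀ (by linarith) (by linarith)]
  linarith

theorem det_blocks_of_symmetric (hV : IsCM JJ V) (hent : nu V < 1) (hs : IsSymmetricState V)
    {T : Matrix TwoModes TwoModes ℝ} {μ : ℝ} (hd : Diagonalizes T μ V) :
    T.toBlocks₁₁.det = 1 / 2 ∧ T.toBlocks₁₂.det = 1 / 2 := by
  have h1 := (isSymmetricState_iff hV hent hd).1 hs
  have h2 := (symplectic_rows hd.1).1
  constructor <;> linarith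

theorem exists_optimal_of_symmetric (hV : IsCM JJ V) (hent : nu V < 1)
    (hs : IsSymmetricState V) :
    ∃ Ea Eb : GCP, fidelity (applyLocal Ea Eb V) = 1 / (1 + nu V) := by
  obtain ⟨T, μ, hd⟩ := exists_diagonalizes hV
  obtain ⟨ha, hb⟩ := det_blocks_of_symmetric hV hent hs hd
  refine ⟨gcpOfSymplectic (√2 • (Z * T.toBlocks₁₁ * Z)) (isSymplectic_J_iff.2
      (det_sqrt_two_smul (by rw [det_Z_mul_mul_Z, ha]))),
    gcpOfSymplectic (√2 • T.toBlocks₁₂) (isSymplectic_J_iff.2 (det_sqrt_two_smul hb)), ?_⟩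
  rw [applyLocal_gcpOfSymplectic, fidelity_localAct hV hd]

theorem Fopt_eq_of_symmetric (hV : IsCM JJ V) (hent : nu V < 1) (hs : IsSymmetricState V) :
    Fopt V = 1 / (1 + nu V) := by
  obtain ⟨Ea, Eb, h⟩ := exists_optimal_of_symmetric hV hent hs
  exact le_antisymm (Fopt_le hV hent) (h ▸ fidelity_le_Fopt hV hent Ea Eb)

theorem Fopt_eq_iff (hV : IsCM JJ V) (hent : nu V < 1) :
    Fopt V = 1 / (1 + nu V) ↔ IsSymmetricState V := by
  refine ⟨fun h => ?_, Fopt_eq_of_symmetric hV hent⟩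
  by_contra hs
  exact (Fopt_lt_of_not_symmetric hV hent hs).ne h

/-- A local map that attains the bound acts as a local symplectic map. -/
theorem localAct_of_optimal (hV : IsCM JJ V) (hent : nu V < 1) {Ea Eb : GCP}
    (h : fidelity (applyLocal Ea Eb V) = 1 / (1 + nu V)) :
    ∃ Sa Sb : Matrix (Fin 2) (Fin 2) ℝ, IsSymplectic J Sa ∧ IsSymplectic J Sb ∧
      ∀ U, applyLocal Ea Eb U = localAct Sa Sb 0 0 U := by
  obtain ⟨T, μ, hd⟩ := exists_diagonalizes hV
  obtain ⟨h0, -, -⟩ := diagonalizes_bounds hV hd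
  have hx : |(-nu V)| < 1 := by rwa [abs_neg, abs_of_pos h0]
  have hy : |nu V| < 1 := by rwa [abs_of_pos h0]
  have hpsd := posSemidef_applyLocal Ea Eb V hx.le hy.le hV.1 (posSemidef_nu hV)
  have e : 1 / (1 + nu V) = 2 / (2 + (nu V - -nu V)) := by
    rw [div_eq_div_iff (by linarith) (by linarith)]
    ring
  -- Attaining `1 / (1 + ν)` is the equality case of the bound at `(-ν, ν)`; it yields the null
  -- vector `(1, -i, 1, i)`, that is, `s = -1` and `t = 1`.
  have hN := (fidelity_bound (by linarith) hpsd).2 (h.trans e)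
  have hz := exists_null_of_noise hpsd hN
  obtain ⟨ha, hb⟩ := decoupled_of_null Ea Eb V hx hy hV.1 (posSemidef_nu hV) hz (s := -1) (t := 1)
    (by norm_num) one_ne_zero (by simp) (by simp) (by simp) (by simp)
  exact ⟨_, _, (dilated_decoupled Ea.S_symplectic ha).1, (dilated_decoupled Eb.S_symplectic hb).1,
    applyLocal_of_decoupled Ea Eb ha hb⟩

theorem inv_cos_pi_div_four : (Real.cos (Real.pi / 4))⁻¹ = √2 := by
  have h := Real.mul_self_sqrt (show (0 : ℝ) ≤ 2 by norm_num)
  have : √2 ≠ 0 := by positivity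
  rw [Real.cos_pi_div_four]
  field_simp
  linarith

end Optimality

end CVTeleport

end

open Matrix CVTeleport in
theorem corollary1 (V : Matrix (Fin 2 ⊕ Fin 2) (Fin 2 ⊕ Fin 2) ℝ)
    (hV : CVTeleport.IsCM CVTeleport.JJ V) (hent : CVTeleport.nu V < 1) :
    -- `1 / (1 + ν)` bounds the optimal fidelity, with equality iff the state is symmetric,
    CVTeleport.Fopt V ≤ 1 / (1 + CVTeleport.nu V) ∧
    (CVTeleport.Fopt V = 1 / (1 + CVTeleport.nu V) ↔ CVTeleport.IsSymmetricState V) ∧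
    -- and a local GCP map attains the bound iff the state is symmetric.
    ((∃ Ea Eb : CVTeleport.GCP,
        CVTeleport.fidelity (CVTeleport.applyLocal Ea Eb V) = 1 / (1 + CVTeleport.nu V)) ↔
      CVTeleport.IsSymmetricState V) ∧
    (CVTeleport.IsSymmetricState V →
      -- Every optimal local GCP map acts as a local symplectic map.
      (∀ Ea Eb : CVTeleport.GCP,
        CVTeleport.fidelity (CVTeleport.applyLocal Ea Eb V) = CVTeleport.Fopt V →
        ∃ Sa Sb : Matrix (Fin 2) (Fin 2) ℝ,
          CVTeleport.IsSymplectic CVTeleport.J Sa ∧ CVTeleport.IsSymplectic CVTeleport.J Sb ∧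
          ∀ U : Matrix (Fin 2 ⊕ Fin 2) (Fin 2 ⊕ Fin 2) ℝ,
            CVTeleport.applyLocal Ea Eb U = CVTeleport.localAct Sa Sb 0 0 U) ∧
      -- Diagonalizations exist, and each of them has `θ = π / 4` and gives an optimal map
      -- `ω_θ`, which is symplectic.
      (∃ T μ, CVTeleport.Diagonalizes T μ V) ∧
      ∀ T μ, CVTeleport.Diagonalizes T μ V →
        T.toBlocks₁₁.det = 1 / 2 ∧ T.toBlocks₁₂.det = 1 / 2 ∧
        CVTeleport.theta T.toBlocks₁₁ T.toBlocks₁₂ = Real.pi / 4 ∧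
        CVTeleport.IsSymplectic CVTeleport.J
          (CVTeleport.omegaSa (Real.pi / 4) T.toBlocks₁₁) ∧
        CVTeleport.IsSymplectic CVTeleport.J
          (CVTeleport.omegaSb (Real.pi / 4) T.toBlocks₁₂) ∧
        CVTeleport.omegaGa (Real.pi / 4) = 0 ∧ CVTeleport.omegaGb (Real.pi / 4) = 0 ∧
        CVTeleport.fidelity
          (CVTeleport.localAct (CVTeleport.omegaSa (Real.pi / 4) T.toBlocks₁₁)
            (CVTeleport.omegaSb (Real.pi / 4) T.toBlocks₁₂)
            (CVTeleport.omegaGa (Real.pi / 4)) (CVTeleport.omegaGb (Real.pi / 4)) V) =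
          CVTeleport.Fopt V) := by
  obtain ⟨T, μ, hd⟩ := exists_diagonalizes hV
  refine ⟨Fopt_le hV hent, Fopt_eq_iff hV hent, ⟨fun ⟨Ea, Eb, h⟩ => ?_,
    exists_optimal_of_symmetric hV hent⟩, fun hs => ⟨fun Ea Eb h => ?_, ⟨T, μ, hd⟩, ?_⟩⟩
  · exact (Fopt_eq_iff hV hent).1
      (le_antisymm (Fopt_le hV hent) (h ▸ fidelity_le_Fopt hV hent Ea Eb))
  · exact localAct_of_optimal hV hent (h.trans (Fopt_eq_of_symmetric hV hent hs))
  · intro T μ hd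
    obtain ⟨ha, hb⟩ := det_blocks_of_symmetric hV hent hs hd
    have ea : omegaSa (Real.pi / 4) T.toBlocks₁₁ = √2 • (Z * T.toBlocks₁₁ * Z) := by
      rw [omegaSa, if_pos le_rfl, inv_cos_pi_div_four]
    have eb : omegaSb (Real.pi / 4) T.toBlocks₁₂ = √2 • T.toBlocks₁₂ := by
      rw [omegaSb, if_pos le_rfl, inv_cos_pi_div_four]
    have ga : omegaGa (Real.pi / 4) = 0 := by
      rw [omegaGa, if_pos le_rfl, Real.tan_pi_div_four, one_pow, sub_self, zero_smul]
    have gb : omegaGb (Real.pi / 4) = 0 := by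
      rw [omegaGb, if_pos le_rfl]
    refine ⟨ha, hb, ?_, ?_, ?_, ga, gb, ?_⟩
    · rw [theta, ha, hb, div_self (by norm_num), Real.sqrt_one, Real.arctan_one]
    · rw [ea, isSymplectic_J_iff]
      exact det_sqrt_two_smul (by rw [det_Z_mul_mul_Z, ha])
    · rw [eb, isSymplectic_J_iff]
      exact det_sqrt_two_smul hb
    · rw [ea, eb, ga, gb, fidelity_localAct hV hd, Fopt_eq_of_symmetric hV hent hs]
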